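/- Let $I=[0,1]$. For a metric space $X$ and a set-valued map $F$ on $X$, let $\mathrm{Orb}_n(F)$ be the set of $n$-tuples $(x_1,\dots,x_n)$ with $x_{j+1}\in F(x_j)$ for $1\le j<n$, let $s_{n,\varepsilon}(F)$ be the largest cardinality of a set $S\subset \mathrm{Orb}_n(F)$ in which any two distinct tuples $(x_j),(y_j)$ satisfy $d(x_j,y_j)>\varepsilon$ for some $j$, and let $$\mathrm{Ent}(F)=\lim_{\varepsilon\to0}\limsup_{n\to\infty}\tfrac1n\log s_{n,\varepsilon}(F)\in[0,\infty];$$ a single-valued map is regarded as a set-valued map with one-point values. By a diagonal system we mean two sequences of continuous maps $f_i,g_i\colon I\to I$ ($i\ge 0$), with every $f_i$ surjective, such that $f_i\circ g_{i+1}=g_i\circ f_{i+1}$ for all $i$. Let $X=\varprojlim(I,f_i)=\{(x_i)_{i\ge0}\in I^{\mathbb N}: f_i(x_{i+1})=x_i \text{ for all } i\}$, with metric $d(x,y)=\sum_{i\ge0}|x_i-y_i|/2^i$, let $\Psi\colon X\to X$ be the diagonal map $\Psi(x_0,x_1,x_2,\dots)=(g_0(x_1),g_1(x_2),g_2(x_3),\dots)$,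 and let $g_i\circ f_i^{-1}$ be the set-valued map $x\mapsto\{g_i(t): f_i(t)=x\}$ on $I$. Let $0\le a\le b\le c\le\infty$ be such that $b=\log n$ for some integer $n\ge1$ or $b=\infty$, and $c=\log m$ for some integer $m\ge1$ or $c=\infty$. Then there is a diagonal system with $$\mathrm{Ent}(\Psi)=a,\qquad \liminf_{i\to\infty}\mathrm{Ent}(g_i\circ f_i^{-1})=b,\qquad \limsup_{i\to\infty}\mathrm{Ent}(g_i\circ f_i^{-1})=c .$$ Consequently, the commutation condition $f_i\circ g_{i+1}=g_i\circ f_{i+1}$ alone (without the further condition $g_{i+1}\circ f_{i+1}^{-1}=f_i^{-1}\circ g_i$) guarantees neither that $\lim_{i\to\infty}\mathrm{Ent}(g_i\circ f_i^{-1})$ exists nor that $\mathrm{Ent}(\Psi)=\liminf_{i\to\infty}\mathrm{Ent}(g_i\circ f_i^{-1})$: there is a diagonal system for which $\lim_{i\to\infty}\mathrm{Ent}(g_i\circ f_i^{-1})$ does not exist in $[0,\infty]$, and there is a diagonal system for which $\mathrm{Ent}(\Psi)<\liminf_{i\to\infty}\mathrm{Ent}(g_i\circ f_i^{-1})$. 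-/

import Mathlib

open Set Filter Topology unitInterval

noncomputable section

/-! ### Entropy of set-valued maps -/

section Entropy

variable {X : Type*}

/-- The `n`-orbits of a set-valued map `F`: the `n`-tuples `(x₁, …, xₙ)` with
`xᵢ₊₁ ∈ F xᵢ` for all `1 ≤ i < n`. -/
def setOrbits (F : X → Set X) (n : ℕ) : Set (Fin n → X) :=
  {x | ∀ (i : ℕ) (hi : i + 1 < n), x ⟨i + 1, hi⟩ ∈ F (x ⟨i, Nat.lt_of_succ_lt hi⟩)}

variable [MetricSpace X]

/-- `S` is an `(n, ε)`-separated set of `n`-orbits of `F`: any two different members are more than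
`ε` apart in some coordinate. -/
def IsOrbitSeparated (F : X → Set X) (n : ℕ) (ε : ℝ) (S : Set (Fin n → X)) : Prop :=
  S ⊆ setOrbits F n ∧ ∀ x ∈ S, ∀ y ∈ S, x ≠ y → ∃ i, ε < dist (x i) (y i)

/-- The largest cardinality of an `(n, ε)`-separated set of `n`-orbits of `F`. -/
def maxSeparated (F : X → Set X) (n : ℕ) (ε : ℝ) : ℕ∞ :=
  ⨆ (S : Set (Fin n → X)) (_ : IsOrbitSeparated F n ε S), S.encard

/-- The exponential growth rate `limsup (1/n) log s_{n,ε}(F)` at scale `ε`. -/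
def entropyAtScale (F : X → Set X) (ε : ℝ) : EReal :=
  limsup (fun n : ℕ => ENNReal.log (maxSeparated F n ε : ENNReal) / (n : EReal)) atTop

/-- Topological entropy of a set-valued map, the limit of `entropyAtScale F ε` as `ε → 0⁺`. Since
that quantity increases as `ε` decreases, the limit is the supremum over `ε > 0`
(see `tendsto_entropyAtScale`). -/
def setEntropy (F : X → Set X) : EReal :=
  ⨆ (ε : ℝ) (_ : 0 < ε), entropyAtScale F ε

/-- Topological entropy of a single-valued map, viewed as a set-valued map with one-point values. -/
def mapEntropy (T : X → X) : EReal :=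
  setEntropy fun x => {T x}

lemma entropyAtScale_anti (F : X → Set X) {ε δ : ℝ} (h : ε ≤ δ) :
    entropyAtScale F δ ≤ entropyAtScale F ε := by
  refine limsup_le_limsup (Eventually.of_forall fun n => ?_)
  refine EReal.div_le_div_right_of_nonneg (by positivity) (ENNReal.log_monotone ?_)
  have : maxSeparated F n δ ≤ maxSeparated F n ε :=
    iSup_mono fun S => iSup_mono' fun hS => ⟨⟨hS.1, fun x hx y hy hxy =>
      (hS.2 x hx y hy hxy).imp fun i hi => lt_of_le_of_lt h hi⟩, le_rfl⟩
  exact_mod_cast this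

theorem tendsto_entropyAtScale (F : X → Set X) :
    Tendsto (entropyAtScale F) (𝓝[>] 0) (𝓝 (setEntropy F)) := by
  refine tendsto_order.2 ⟨fun u hu => ?_, fun u hu => ?_⟩
  · obtain ⟨ε, hε⟩ := lt_iSup_iff.1 hu
    obtain ⟨h0, hε⟩ := lt_iSup_iff.1 hε
    filter_upwards [Ioo_mem_nhdsGT h0] with δ hδ
    exact hε.trans_le (entropyAtScale_anti F hδ.2.le)
  · filter_upwards [self_mem_nhdsWithin] with δ hδ
    exact (le_iSup₂ (f := fun (ε : ℝ) (_ : 0 < ε) => entropyAtScale F ε) δ hδ).trans_lt hu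

end Entropy

/-! ### Inverse limits of the unit interval -/

/-- The inverse limit of the inverse sequence `I ← I ← I ← ⋯`, whose `i`-th bonding map
`f i` goes from the coordinate `i + 1` to the coordinate `i`. -/
@[ext]
structure IntervalInverseLimit (f : ℕ → C(I, I)) where
  coord : ℕ → I
  bonding : ∀ i, f i (coord (i + 1)) = coord i

namespace IntervalInverseLimit

variable {f : ℕ → C(I, I)}

lemma summable_dist (x y : IntervalInverseLimit f) :
    Summable fun i : ℕ => dist (x.coord i) (y.coord i) / 2 ^ i := by
  refine Summable.of_nonneg_of_le (fun i => by positivity) (fun i => ?_) summable_geometric_two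
  rw [div_eq_mul_inv, one_div, inv_pow]
  refine mul_le_of_le_one_left (by positivity) ?_
  rw [Subtype.dist_eq, Real.dist_eq, abs_le]
  have h1 := (x.coord i).2
  have h2 := (y.coord i).2
  constructor <;> linarith [h1.1, h1.2, h2.1, h2.2]

/-- The metric `d(x, y) = ∑ |xᵢ - yᵢ| / 2ⁱ`. -/
instance : MetricSpace (IntervalInverseLimit f) where
  dist x y := ∑' i : ℕ, dist (x.coord i) (y.coord i) / 2 ^ i
  dist_self x := by simp
  dist_comm x y := by simp only [dist_comm]
  dist_triangle x y z := by
    rw [← (summable_dist x y).tsum_add (summable_dist y z)]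
    refine (summable_dist x z).tsum_le_tsum (fun i => ?_)
      ((summable_dist x y).add (summable_dist y z))
    rw [← add_div]
    gcongr
    exact dist_triangle _ _ _
  eq_of_dist_eq_zero := by
    intro x y h
    have h' := (hasSum_zero_iff_of_nonneg (fun i => by positivity)).1
      (h ▸ (summable_dist x y).hasSum)
    refine IntervalInverseLimit.ext (funext fun i => ?_)
    have := congrFun h' i
    simpa using this

end IntervalInverseLimit

/-- The diagonal map `Ψ(x₀, x₁, x₂, …) = (g₀(x₁), g₁(x₂), g₂(x₃), …)` of the inverse limit,
where `f i ∘ g (i + 1) = g i ∘ f (i + 1)`. -/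
def diagonalMap (f g : ℕ → C(I, I))
    (h : ∀ i, (f i).comp (g (i + 1)) = (g i).comp (f (i + 1)))
    (x : IntervalInverseLimit f) : IntervalInverseLimit f where
  coord i := g i (x.coord (i + 1))
  bonding i := by
    have := DFunLike.congr_fun (h i) (x.coord (i + 1 + 1))
    simp only [ContinuousMap.comp_apply] at this
    rw [this, x.bonding]

/-- The set-valued map `g ∘ f⁻¹`, sending `x` to `{g t | f t = x}`. -/
def compInv (g f : C(I, I)) (x : I) : Set I :=
  g '' (f ⁻¹' {x})

end

/-! ### Bounds for the entropy of set-valued maps -/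

/-! A fold can create entropy in a set-valued map that the diagonal map never sees. Let λ be
`collapseLeft`, which collapses the left half of I to 0. Start from T₀ = D and let Tᵢ₊₁ act as Eᵢ on
the left half and as Tᵢ on the right half, so that λ ∘ Tᵢ₊₁ = Tᵢ ∘ λ. Let φ₀ = id, and let φᵢ₊₁ fold
the left half by αᵢ and fix the right half, so that λ ∘ φᵢ₊₁ = λ. Put fᵢ = φᵢ ∘ λ and gᵢ = φᵢ ∘ Tᵢ ∘
λ. Both sides of the commutation condition equal φᵢ ∘ Tᵢ ∘ λ ∘ λ.

Since λ removes the fold, Ψ factors onto every Tᵢ; conversely, at each scale the orbits of Ψ are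
controlled by those of some Tᵢ (`mapEntropy_towerMap_le_diagonalMap`,
`entropyBound_diagonalMap_tower`). But gᵢ ∘ fᵢ⁻¹ = φᵢ ∘ Tᵢ ∘ φᵢ⁻¹ does see the fold
(`compInv_tower`).

For finite a, D is a triangle wave of slope eᵃ, of entropy a: the upper bound is the Lipschitz one,
the lower bound measures Bowen balls. Each Eᵢ is a monotone staircase, of entropy 0, so Ψ has
entropy a. The zigzag αᵢ is chosen so that αᵢ ∘ Eᵢ ∘ αᵢ⁻¹ contains a complete graph on Nᵢ points and
has entropy exactly log Nᵢ (`foldPoint_mem_foldRel`, `entropyBound_foldRel_zigzag`). As a ≤ log Nᵢ,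
this is also the entropy at level i + 1, and interleaving two sequences of integers gives b and c.
For a = ∞ no folds are needed: the Eᵢ are waves of growing slope. -/

lemma iterate_mem_setOrbits {X : Type*} (T : X → X) (n : ℕ) (x : X) :
    (fun i : Fin n => T^[i] x) ∈ setOrbits (fun x => {T x}) n :=
  fun i _ => Function.iterate_succ_apply' T i x

lemma eq_iterate_of_mem_setOrbits {X : Type*} {T : X → X} {n : ℕ} {x : Fin n → X}
    (hx : x ∈ setOrbits (fun x => {T x}) n) (h0 : 0 < n) (i : Fin n) :
    x i = T^[i] (x ⟨0, h0⟩) := by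
  obtain ⟨i, hi⟩ := i
  induction i with
  | zero => rfl
  | succ i ih =>
    have := hx i hi
    rw [mem_singleton_iff] at this
    rw [this, ih, Function.iterate_succ_apply']

section EntropyBounds

variable {X Y : Type*} [MetricSpace X] [MetricSpace Y]

/-- The separated sets of `F` grow at exponential rate at most `A`, at every scale. -/
def EntropyBound (F : X → Set X) (A : ℝ) : Prop :=
  ∀ ε > 0, ∀ B > A, ∃ C : ℝ, ∀ (n : ℕ) (S : Set (Fin n → X)), IsOrbitSeparated F n ε S →
    S.Finite ∧ (S.ncard : ℝ) ≤ C * Real.exp (B * n)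

lemma EntropyBound.mono {F : X → Set X} {A A' : ℝ} (h : EntropyBound F A) (hA : A ≤ A') :
    EntropyBound F A' :=
  fun ε hε B hB => h ε hε B (lt_of_le_of_lt hA hB)

lemma EntropyBound.setEntropy_le {F : X → Set X} {A : ℝ} (h : EntropyBound F A) :
    setEntropy F ≤ A := by
  refine iSup₂_le fun ε hε => ?_
  refine EReal.le_of_forall_lt_iff_le.1 fun B hB => ?_
  have hB : A < B := by exact_mod_cast hB
  -- The gap between `B'` and `B` absorbs the constant `C` for large `n`.
  obtain ⟨B', hAB', hB'⟩ := exists_between hB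
  obtain ⟨C, hC⟩ := h ε hε B' hAB'
  have hev : ∀ᶠ n : ℕ in atTop, C ≤ Real.exp ((B - B') * n) :=
    (Real.tendsto_exp_atTop.comp
      (tendsto_natCast_atTop_atTop.const_mul_atTop (sub_pos.2 hB'))).eventually_ge_atTop C
  refine limsup_le_of_le (by isBoundedDefault) ?_
  filter_upwards [hev, eventually_gt_atTop 0] with n hn hn0
  have h1 : (maxSeparated F n ε : ENNReal) ≤ ENNReal.ofReal (Real.exp (B * n)) := by
    have h2 : maxSeparated F n ε ≤ (⌊Real.exp (B * n)⌋₊ : ℕ∞) := by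
      refine iSup₂_le fun S hS => ?_
      obtain ⟨hf, hc⟩ := hC n S hS
      rw [← hf.cast_ncard_eq]
      refine Nat.cast_le.2 (Nat.le_floor (hc.trans ?_))
      have : Real.exp (B * n) = Real.exp ((B - B') * n) * Real.exp (B' * n) := by
        rw [← Real.exp_add]; ring_nf
      rw [this]
      exact mul_le_mul_of_nonneg_right hn (Real.exp_pos _).le
    calc (maxSeparated F n ε : ENNReal) ≤ ((⌊Real.exp (B * n)⌋₊ : ℕ∞) : ENNReal) := by
          exact_mod_cast h2
      _ = ENNReal.ofReal (⌊Real.exp (B * n)⌋₊ : ℝ) := by simp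
      _ ≤ _ := ENNReal.ofReal_le_ofReal (Nat.floor_le (Real.exp_pos _).le)
  have hn0' : (0 : EReal) < n := by exact_mod_cast hn0
  rw [EReal.div_le_iff_le_mul hn0' (EReal.natCast_ne_top n)]
  refine (ENNReal.log_monotone h1).trans ?_
  rw [ENNReal.log_ofReal_of_pos (Real.exp_pos _), Real.log_exp, mul_comm (n : EReal)]
  push_cast
  exact le_rfl

lemma le_setEntropy_of_frequently {F : X → Set X} {B ε : ℝ} (hε : 0 < ε)
    (h : ∃ᶠ n : ℕ in atTop, ENNReal.ofReal (Real.exp (B * n)) ≤ maxSeparated F n ε) :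
    (B : EReal) ≤ setEntropy F := by
  refine le_trans ?_ (le_iSup₂ (f := fun (ε : ℝ) (_ : 0 < ε) => entropyAtScale F ε) ε hε)
  refine le_limsup_of_frequently_le ((h.and_eventually (eventually_gt_atTop 0)).mono ?_)
  rintro n ⟨hn, hn0⟩
  have hn0' : (0 : EReal) < n := by exact_mod_cast hn0
  rw [EReal.le_div_iff_mul_le hn0' (EReal.natCast_ne_top n)]
  refine le_trans ?_ (ENNReal.log_monotone hn)
  rw [ENNReal.log_ofReal_of_pos (Real.exp_pos _), Real.log_exp]
  push_cast
  exact le_rfl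

lemma IsOrbitSeparated.encard_le {F : X → Set X} {n : ℕ} {ε : ℝ} {S : Set (Fin n → X)}
    (h : IsOrbitSeparated F n ε S) : S.encard ≤ maxSeparated F n ε :=
  le_iSup₂ (f := fun S (_ : IsOrbitSeparated F n ε S) => S.encard) S h

/-- Separated sets can be transported along maps that do not bring separated points together. -/
lemma IsOrbitSeparated.image {F : X → Set X} {G : Y → Set Y} {n : ℕ} {ε δ : ℝ}
    {S : Set (Fin n → X)} (h : IsOrbitSeparated F n ε S) (hδ : 0 ≤ δ) (Φ : (Fin n → X) → Fin n → Y)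
    (hΦ : ∀ x ∈ S, Φ x ∈ setOrbits G n)
    (hd : ∀ x ∈ S, ∀ y ∈ S, ∀ i, dist (Φ x i) (Φ y i) ≤ δ → dist (x i) (y i) ≤ ε) :
    InjOn Φ S ∧ IsOrbitSeparated G n δ (Φ '' S) := by
  have key : ∀ x ∈ S, ∀ y ∈ S, x ≠ y → ∃ i, δ < dist (Φ x i) (Φ y i) := by
    intro x hx y hy hxy
    obtain ⟨i, hi⟩ := h.2 x hx y hy hxy
    exact ⟨i, lt_of_not_ge fun hc => (hd x hx y hy i hc).not_gt hi⟩
  refine ⟨fun x hx y hy hxy => ?_, ?_, ?_⟩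
  · by_contra hne
    obtain ⟨i, hi⟩ := key x hx y hy hne
    rw [hxy, dist_self] at hi
    exact hδ.not_gt hi
  · rintro _ ⟨x, hx, rfl⟩
    exact hΦ x hx
  · rintro _ ⟨x, hx, rfl⟩ _ ⟨y, hy, rfl⟩ hne
    exact key x hx y hy fun e => hne (by rw [e])

/-- Orbits with equal codes are never separated, so a separated set injects into the set of codes.
All upper bounds on entropy below start from such a count. -/
lemma EntropyBound.of_code {F : X → Set X} {A : ℝ}
    (h : ∀ ε > 0, ∀ B > A, ∃ C : ℝ, ∀ n : ℕ, ∃ (κ : Type) (t : Finset κ) (c : (Fin n → X) → κ),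
      (t.card : ℝ) ≤ C * Real.exp (B * n) ∧ (∀ x ∈ setOrbits F n, c x ∈ t) ∧
      ∀ x ∈ setOrbits F n, ∀ y ∈ setOrbits F n, c x = c y → ∀ i, dist (x i) (y i) ≤ ε) :
    EntropyBound F A := by
  intro ε hε B hB
  obtain ⟨C, hC⟩ := h ε hε B hB
  refine ⟨C, fun n S hS => ?_⟩
  obtain ⟨κ, t, c, ht, hmem, hc⟩ := hC n
  have hinj : InjOn c S := by
    intro x hx y hy hxy
    by_contra hne
    obtain ⟨i, hi⟩ := hS.2 x hx y hy hne
    exact (hc x (hS.1 hx) y (hS.1 hy) hxy i).not_gt hi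
  have hmaps : MapsTo c S (t : Set κ) := fun x hx => hmem x (hS.1 hx)
  refine ⟨Set.Finite.of_injOn hmaps hinj t.finite_toSet, le_trans ?_ ht⟩
  have := ncard_le_ncard_of_injOn c hmaps hinj t.finite_toSet
  rw [ncard_coe_finset] at this
  exact_mod_cast this

/-- An entropy bound passes from `G` to `F` if, at every scale, the orbits of `F` are controlled
by their images among the orbits of some such `G`. -/
lemma EntropyBound.of_approx {F : X → Set X} {A : ℝ}
    (h : ∀ ε > 0, ∃ (G : Y → Set Y) (φ : X → Y) (δ : ℝ), EntropyBound G A ∧ 0 < δ ∧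
      (∀ x, ∀ y ∈ F x, φ y ∈ G (φ x)) ∧ ∀ x y, dist (φ x) (φ y) ≤ δ → dist x y ≤ ε) :
    EntropyBound F A := by
  intro ε hε B hB
  obtain ⟨G, φ, δ, hG, hδ, hφ, hd⟩ := h ε hε
  obtain ⟨C, hC⟩ := hG δ hδ B hB
  refine ⟨C, fun n S hS => ?_⟩
  obtain ⟨hinj, hsep⟩ := hS.image (G := G) hδ.le (fun x i => φ (x i))
    (fun x hx i hi => hφ _ _ (hS.1 hx i hi)) (fun x _ y _ i => hd _ _)
  obtain ⟨hf, hc⟩ := hC n _ hsep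
  exact ⟨hf.of_finite_image hinj, by rwa [hinj.ncard_image] at hc⟩

/-- The entropy of a factor is at most the entropy of the extension. -/
lemma mapEntropy_le_of_semiconj {T : X → X} {S : Y → Y} {π : Y → X}
    (hπ : Function.Semiconj π S T) (hsurj : Function.Surjective π) (hc : UniformContinuous π) :
    mapEntropy T ≤ mapEntropy S := by
  refine iSup₂_le fun ε hε => ?_
  obtain ⟨δ, hδ, hδε⟩ := Metric.uniformContinuous_iff.1 hc ε hε
  refine le_trans ?_ (le_iSup₂ (f := fun (ε : ℝ) (_ : 0 < ε) => entropyAtScale _ ε) (δ / 2)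
    (half_pos hδ))
  refine limsup_le_limsup (Eventually.of_forall fun n => ?_)
  refine EReal.div_le_div_right_of_nonneg (by positivity) (ENNReal.log_monotone ?_)
  have : maxSeparated (fun x => {T x}) n ε ≤ maxSeparated (fun y => {S y}) n (δ / 2) := by
    refine iSup₂_le fun A hA => ?_
    rcases Nat.eq_zero_or_pos n with rfl | hn
    · obtain ⟨hinj, hsep⟩ := hA.image (G := fun y => {S y}) (δ := δ / 2) (half_pos hδ).le
        (fun _ i => i.elim0) (fun x _ i hi => by omega) (fun x _ y _ i => i.elim0)
      rw [← hinj.encard_image]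
      exact hsep.encard_le
    -- An orbit is lifted by lifting its initial point and iterating `S`; lifting its points
    -- separately would not give an orbit.
    · obtain ⟨r, hr⟩ := hsurj.hasRightInverse
      obtain ⟨hinj, hsep⟩ := hA.image (G := fun y => {S y}) (δ := δ / 2) (half_pos hδ).le
        (fun x i => S^[i] (r (x ⟨0, hn⟩))) (fun x _ => iterate_mem_setOrbits S n _)
        (fun x hx y hy i hi => by
          have h1 : ∀ z ∈ A, z i = π (S^[i] (r (z ⟨0, hn⟩))) := fun z hz => by
            rw [(hπ.iterate_right i).eq, hr, eq_iterate_of_mem_setOrbits (hA.1 hz) hn]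
          rw [h1 x hx, h1 y hy]
          exact (hδε (lt_of_le_of_lt hi (half_lt_self hδ))).le)
      rw [← hinj.encard_image]
      exact hsep.encard_le
  exact_mod_cast this

/-- A full transition graph on `N` points forces entropy at least `log N`. -/
lemma log_le_setEntropy_of_full_graph {F : X → Set X} {N : ℕ} (hN : 1 ≤ N) {p : Fin N → X}
    (hp : Function.Injective p) (hF : ∀ j l, p l ∈ F (p j)) :
    ((Real.log N : ℝ) : EReal) ≤ setEntropy F := by
  obtain ⟨ε, hε, hsep⟩ : ∃ ε > 0, ∀ j l, j ≠ l → ε < dist (p j) (p l) := by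
    obtain ⟨ε, hε, h⟩ : ∃ ε > 0, ∀ q : Fin N × Fin N, q.1 ≠ q.2 → ε < dist (p q.1) (p q.2) := by
      have : ∀ᶠ ε in 𝓝[>] (0 : ℝ), ∀ q : Fin N × Fin N, q.1 ≠ q.2 → ε < dist (p q.1) (p q.2) := by
        refine eventually_all.2 fun q => ?_
        by_cases hq : q.1 = q.2
        · exact Eventually.of_forall fun _ h => absurd hq h
        · filter_upwards [Ioo_mem_nhdsGT (dist_pos.2 (hp.ne hq))] with ε hε _ using hε.2
      obtain ⟨ε, h, hε⟩ := (this.and self_mem_nhdsWithin).exists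
      exact ⟨ε, hε, h⟩
    exact ⟨ε, hε, fun j l => h (j, l)⟩
  refine le_setEntropy_of_frequently hε (Frequently.of_forall fun n => ?_)
  have hinj : Function.Injective fun (w : Fin n → Fin N) (i : Fin n) => p (w i) :=
    fun w v h => funext fun i => hp (congrFun h i)
  have : IsOrbitSeparated F n ε (range fun (w : Fin n → Fin N) (i : Fin n) => p (w i)) := by
    refine ⟨?_, ?_⟩
    · rintro _ ⟨w, rfl⟩ i hi
      exact hF _ _
    · rintro _ ⟨w, rfl⟩ _ ⟨v, rfl⟩ h
      obtain ⟨i, hi⟩ := Function.ne_iff.1 h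
      exact ⟨i, hsep _ _ fun e => hi (by simp only [e])⟩
  have h := this.encard_le
  rw [← image_univ, hinj.injOn.encard_image, encard_univ, ENat.card_eq_coe_fintype_card,
    Fintype.card_fun, Fintype.card_fin, Fintype.card_fin] at h
  have hN' : (0 : ℝ) < N := by exact_mod_cast hN
  have h2 : Real.exp (Real.log N * n) = ((N ^ n : ℕ) : ℝ) := by
    rw [mul_comm, Real.exp_nat_mul, Real.exp_log hN', Nat.cast_pow]
  rw [h2, ENNReal.ofReal_natCast]
  exact_mod_cast h

end EntropyBounds

/-! ### Counting by cells of length ε, and monotone maps -/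

lemma natCast_add_one_le_mul_exp {δ : ℝ} (hδ : 0 < δ) (n : ℕ) :
    (n : ℝ) + 1 ≤ (1 + 1 / δ) * Real.exp (δ * n) := by
  have h1 := Real.add_one_le_exp (δ * n)
  have h2 : 1 ≤ Real.exp (δ * n) := Real.one_le_exp (by positivity)
  have h3 : (n : ℝ) = 1 / δ * (δ * n) := by field_simp
  have h4 : 1 / δ * (δ * n) ≤ 1 / δ * Real.exp (δ * n) := by
    gcongr
    linarith
  linarith

lemma floor_div_le_floor_one_div {ε : ℝ} (hε : 0 < ε) (x : I) : ⌊(x : ℝ) / ε⌋₊ ≤ ⌊1 / ε⌋₊ :=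
  Nat.floor_mono (by gcongr; exact x.2.2)

lemma dist_le_of_floor_div_eq {ε : ℝ} (hε : 0 < ε) {x y : I}
    (h : ⌊(x : ℝ) / ε⌋₊ = ⌊(y : ℝ) / ε⌋₊) : dist x y ≤ ε := by
  have hx := Nat.floor_le (div_nonneg x.2.1 hε.le)
  have hy := Nat.floor_le (div_nonneg y.2.1 hε.le)
  have hx' := Nat.lt_floor_add_one ((x : ℝ) / ε)
  have hy' := Nat.lt_floor_add_one ((y : ℝ) / ε)
  rw [h] at hx hx'
  rw [Subtype.dist_eq, Real.dist_eq]
  have : |(x : ℝ) / ε - y / ε| ≤ 1 := abs_le.2 ⟨by linarith, by linarith⟩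
  rwa [← sub_div, abs_div, abs_of_pos hε, div_le_one hε] at this

/-- A monotone interval map has zero entropy: the sum of the cells visited by an orbit determines
all of them. -/
lemma Monotone.entropyBound {T : I → I} (hT : Monotone T) :
    EntropyBound (fun x => {T x}) 0 := by
  refine EntropyBound.of_code fun ε hε B hB => ?_
  refine ⟨(1 + 1 / B) * (⌊1 / ε⌋₊ + 1), fun n => ⟨ℕ, Finset.range (n * ⌊1 / ε⌋₊ + 1),
    fun x => ∑ i, ⌊(x i : ℝ) / ε⌋₊, ?_, ?_, ?_⟩⟩
  · rw [Finset.card_range]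
    have h1 := natCast_add_one_le_mul_exp hB n
    push_cast
    have h2 : (0 : ℝ) ≤ ⌊1 / ε⌋₊ := by positivity
    calc (n : ℝ) * ⌊1 / ε⌋₊ + 1 ≤ (n + 1) * (⌊1 / ε⌋₊ + 1) := by
          have : (0 : ℝ) ≤ n := by positivity
          nlinarith
      _ ≤ (1 + 1 / B) * Real.exp (B * n) * (⌊1 / ε⌋₊ + 1) := by gcongr
      _ = _ := by ring
  · intro x _
    rw [Finset.mem_range, Nat.lt_succ_iff]
    refine (Finset.sum_le_card_nsmul _ _ _ fun i _ => floor_div_le_floor_one_div hε (x i)).trans ?_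
    simp
  -- Monotonicity keeps two orbits in the order of their initial points, hence also their cell
  -- indices; termwise ordered sums agree only if all terms do.
  · have key : ∀ x ∈ setOrbits (fun x => {T x}) n, ∀ y ∈ setOrbits (fun x => {T x}) n,
        ∀ h0 : 0 < n, x ⟨0, h0⟩ ≤ y ⟨0, h0⟩ →
        ∑ i, ⌊(x i : ℝ) / ε⌋₊ = ∑ i, ⌊(y i : ℝ) / ε⌋₊ → ∀ i, dist (x i) (y i) ≤ ε := by
      intro x hx y hy h0 hle hsum i
      have hxy : ∀ i, ⌊(x i : ℝ) / ε⌋₊ ≤ ⌊(y i : ℝ) / ε⌋₊ := fun i => by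
        refine Nat.floor_mono ?_
        gcongr
        rw [eq_iterate_of_mem_setOrbits hx h0, eq_iterate_of_mem_setOrbits hy h0]
        exact hT.iterate i hle
      exact dist_le_of_floor_div_eq hε
        ((Finset.sum_eq_sum_iff_of_le fun i _ => hxy i).1 hsum i (Finset.mem_univ i))
    intro x hx y hy h i
    rcases le_total (x ⟨0, i.pos⟩) (y ⟨0, i.pos⟩) with hle | hle
    · exact key x hx y hy i.pos hle h i
    · rw [dist_comm]
      exact key y hy x hx i.pos hle h.symm i

/-! ### The triangle wave -/

/-- The distance of a real number to the nearest even integer. -/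
noncomputable def triWave (t : ℝ) : ℝ := |t - 2 * round (t / 2)|

lemma triWave_nonneg (t : ℝ) : 0 ≤ triWave t := abs_nonneg _

lemma triWave_le (t : ℝ) (z : ℤ) : triWave t ≤ |t - 2 * z| := by
  have h := round_le (t / 2) z
  have h1 : ∀ w : ℝ, |t - 2 * w| = 2 * |t / 2 - w| := fun w => by
    rw [← abs_of_pos (two_pos (α := ℝ)), ← abs_mul, abs_of_pos (two_pos (α := ℝ))]
    ring_nf
  rw [triWave, h1, h1]
  linarith

lemma triWave_le_one (t : ℝ) : triWave t ≤ 1 := by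
  have h := abs_le.1 (abs_sub_round (t / 2))
  exact abs_le.2 ⟨by linarith [h.1], by linarith [h.2]⟩

/-- Distinct even integers are at least 2 apart, so one within distance 1 of `t` realizes the
minimum. -/
lemma triWave_eq {t : ℝ} {z : ℤ} (h : |t - 2 * z| ≤ 1) : triWave t = |t - 2 * z| := by
  refine le_antisymm (triWave_le t z) ?_
  rw [triWave]
  by_cases hz : round (t / 2) = z
  · rw [hz]
  · have h1 : (1 : ℝ) ≤ |((round (t / 2) : ℤ) : ℝ) - z| := by
      exact_mod_cast Int.one_le_abs (sub_ne_zero.2 hz)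
    have h2 : |(2 : ℝ) * (round (t / 2) - z)| ≤ |t - 2 * z| + |t - 2 * round (t / 2)| := by
      rw [show (2 : ℝ) * (round (t / 2) - z) = (t - 2 * z) - (t - 2 * round (t / 2)) by ring]
      exact abs_sub _ _
    rw [abs_mul, abs_of_pos (two_pos (α := ℝ))] at h2
    linarith

lemma abs_triWave_sub_le (a b : ℝ) : |triWave a - triWave b| ≤ |a - b| := by
  have key : ∀ a b, triWave a - triWave b ≤ |a - b| := fun a b => by
    have h1 := triWave_le a (round (b / 2))
    have h2 := abs_add_le (a - b) (b - 2 * round (b / 2))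
    rw [sub_add_sub_cancel] at h2
    rw [triWave.eq_def b]
    linarith
  exact abs_sub_le_iff.2 ⟨key a b, abs_sub_comm a b ▸ key b a⟩

lemma continuous_triWave : Continuous triWave :=
  (LipschitzWith.of_dist_le_mul (K := 1) fun a b => by
    simpa [Real.dist_eq] using abs_triWave_sub_le a b).continuous

lemma triWave_neg (t : ℝ) : triWave (-t) = triWave t := by
  have key : ∀ t, triWave (-t) ≤ triWave t := fun t => by
    have := triWave_le (-t) (-round (t / 2))
    rwa [show -t - 2 * ((-round (t / 2) : ℤ) : ℝ) = -(t - 2 * round (t / 2)) by push_cast; ring,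
      abs_neg] at this
  refine le_antisymm (key t) ?_
  simpa using key (-t)

/-- `φ` is affine with slope `±s` on each side of every point. -/
def LocallyAffine (φ : ℝ → ℝ) (s : ℝ) : Prop :=
  ∀ x e : ℝ, |e| = 1 → ∃ u₀ : ℝ, |u₀| = s ∧ ∃ δ > 0, ∀ h ∈ Icc 0 δ, φ (x + e * h) = φ x + u₀ * h

/-- Near a point, each side is carried by φ affinely to one side of the image point, in direction
`u₀ / s`, where ψ is affine again; the slopes multiply. -/
lemma LocallyAffine.comp {φ ψ : ℝ → ℝ} {r s : ℝ} (hψ : LocallyAffine ψ r)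
    (hφ : LocallyAffine φ s) (hs : 0 < s) : LocallyAffine (ψ ∘ φ) (r * s) := by
  intro x e he
  obtain ⟨u₀, hu₀, δ, hδ, h⟩ := hφ x e he
  obtain ⟨τ, hτ, δ', hδ', h'⟩ := hψ (φ x) (u₀ / s)
    (by rw [abs_div, hu₀, abs_of_pos hs, div_self hs.ne'])
  refine ⟨τ * s, by rw [abs_mul, hτ, abs_of_pos hs], min δ (δ' / s), by positivity, ?_⟩
  rintro u ⟨hu0, hu⟩
  have hu1 := hu.trans (min_le_left _ _)
  have hu2 : s * u ≤ δ' := by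
    have := hu.trans (min_le_right _ _)
    rwa [le_div_iff₀ hs, mul_comm] at this
  have := h' (s * u) ⟨by positivity, hu2⟩
  rw [Function.comp_apply, h u ⟨hu0, hu1⟩, Function.comp_apply, mul_assoc, ← this]
  congr 1
  field_simp

lemma LocallyAffine.iterate {φ : ℝ → ℝ} {s : ℝ} (hφ : LocallyAffine φ s) (hs : 0 < s) (m : ℕ) :
    LocallyAffine φ^[m] (s ^ m) := by
  induction m with
  | zero => exact fun x e he => ⟨e, by simpa using he, 1, one_pos, fun h _ => rfl⟩
  | succ m ih =>
    rw [Function.iterate_succ, pow_succ]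
    exact ih.comp hφ hs

lemma locallyAffine_triWave : LocallyAffine triWave 1 := by
  have key : ∀ x : ℝ, ∃ u₀ : ℝ, |u₀| = 1 ∧ ∃ δ > 0, ∀ h ∈ Icc 0 δ,
      triWave (x + h) = triWave x + u₀ * h := by
    intro x
    have h1 := Int.floor_le ((x + 1) / 2)
    have h2 := Int.lt_floor_add_one ((x + 1) / 2)
    -- This gives `2 * z - 1 ≤ x < 2 * z + 1`, which leaves room to the right of `x` where `2 * z`
    -- stays the nearest even integer. The other direction follows by evenness.
    set z := ⌊(x + 1) / 2⌋
    rcases le_or_gt (2 * (z : ℝ)) x with hx | hx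
    · refine ⟨1, abs_one, 2 * z + 1 - x, by linarith, fun h hh => ?_⟩
      have e1 : |x - 2 * z| = x - 2 * z := abs_of_nonneg (by linarith)
      have e2 : |x + h - 2 * z| = x + h - 2 * z := abs_of_nonneg (by linarith [hh.1])
      rw [triWave_eq (t := x) (z := z) (by rw [e1]; linarith),
        triWave_eq (t := x + h) (z := z) (by rw [e2]; linarith [hh.2]), e1, e2]
      ring
    · refine ⟨-1, by simp, 2 * z - x, by linarith, fun h hh => ?_⟩
      have e1 : |x - 2 * z| = -(x - 2 * z) := abs_of_nonpos (by linarith)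
      have e2 : |x + h - 2 * z| = -(x + h - 2 * z) := abs_of_nonpos (by linarith [hh.2])
      rw [triWave_eq (t := x) (z := z) (by rw [e1]; linarith),
        triWave_eq (t := x + h) (z := z) (by rw [e2]; linarith [hh.1]), e1, e2]
      ring
  intro x e he
  rcases eq_or_eq_neg_of_abs_eq he with rfl | rfl
  · simpa using key x
  · obtain ⟨u₀, hu₀, δ, hδ, h⟩ := key (-x)
    refine ⟨u₀, hu₀, δ, hδ, fun u hu => ?_⟩
    rw [← triWave_neg, ← triWave_neg x, ← h u hu]
    ring_nf

lemma locallyAffine_triWave_mul {l : ℝ} (hl : 0 < l) :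
    LocallyAffine (fun x => triWave (l * x)) l := by
  have h : LocallyAffine (fun x => l * x) l := fun x e he =>
    ⟨l * e, by rw [abs_mul, he, abs_of_pos hl, mul_one], 1, one_pos, fun h _ => by ring⟩
  have := locallyAffine_triWave.comp h hl
  rwa [one_mul] at this

/-! ### Entropy of interval maps of constant slope -/

section BowenBalls

open MeasureTheory

lemma volume_preimage_affine {a : ℝ} (ha : a ≠ 0) (c x : ℝ) (A : Set ℝ) :
    volume {y | c + a * (y - x) ∈ A} = ENNReal.ofReal |a⁻¹| * volume A := by
  have : {y | c + a * (y - x) ∈ A} =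
      (fun y => a * y) ⁻¹' ((fun z => (c - a * x) + z) ⁻¹' A) := by
    ext y
    simp only [mem_ofPred_eq, mem_preimage]
    ring_nf
  rw [this, Real.volume_preimage_mul_left ha, measure_preimage_add]

/-- Near `x`, φ is affine of slope `±s` on each side, and each of the two affine maps pulls `A` back
to a set of measure `|A| / s`. -/
lemma LocallyAffine.exists_volume_le {φ : ℝ → ℝ} {s : ℝ} (hφ : LocallyAffine φ s) (hs : 0 < s)
    (x : ℝ) : ∃ δ > 0, ∀ A : Set ℝ,
      volume {y | y ∈ Metric.ball x δ ∧ φ y ∈ A} ≤ ENNReal.ofReal (2 / s) * volume A := by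
  obtain ⟨u₀, hu₀, δ, hδ, h⟩ := hφ x 1 abs_one
  obtain ⟨τ, hτ, δ', hδ', h'⟩ := hφ x (-1) (by simp)
  refine ⟨min δ δ', lt_min hδ hδ', fun A => ?_⟩
  have hu₀0 : u₀ ≠ 0 := abs_pos.1 (hu₀ ▸ hs)
  have hτ0 : -τ ≠ 0 := neg_ne_zero.2 (abs_pos.1 (hτ ▸ hs))
  have hsub : {y | y ∈ Metric.ball x (min δ δ') ∧ φ y ∈ A} ⊆
      {y | φ x + u₀ * (y - x) ∈ A} ∪ {y | φ x + -τ * (y - x) ∈ A} := by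
    rintro y ⟨hy, hyA⟩
    rw [Metric.mem_ball, Real.dist_eq, lt_min_iff] at hy
    have hy1 := abs_lt.1 hy.1
    have hy2 := abs_lt.1 hy.2
    rcases le_total x y with hxy | hxy
    · left
      have := h (y - x) ⟨by linarith, by linarith⟩
      rw [one_mul, add_sub_cancel] at this
      rwa [mem_ofPred_eq, ← this]
    · right
      have := h' (x - y) ⟨by linarith, by linarith⟩
      rw [show x + -1 * (x - y) = y by ring] at this
      rwa [mem_ofPred_eq, show -τ * (y - x) = τ * (x - y) by ring, ← this]
  refine (measure_mono hsub).trans ((measure_union_le _ _).trans ?_)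
  rw [volume_preimage_affine hu₀0, volume_preimage_affine hτ0, abs_inv, abs_inv, abs_neg, hu₀, hτ,
    ← add_mul, ← ENNReal.ofReal_add (by positivity) (by positivity)]
  refine le_of_eq ?_
  congr 2
  ring

/-- A Lebesgue number for the neighbourhoods of the local estimate gives one scale for all `k`. At
that scale φ maps a Bowen ball of order `k + 1` into one of order `k` around `φ x`, so each order
costs a factor `2 / s`. -/
lemma LocallyAffine.exists_volume_bowen_le {φ : ℝ → ℝ} {s : ℝ} (hφ : LocallyAffine φ s)
    (hs : 0 < s) (hmaps : MapsTo φ (Icc 0 1) (Icc 0 1)) : ∃ ε > 0, ∀ (k : ℕ), ∀ x ∈ Icc (0 : ℝ) 1,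
      volume {y | y ∈ Icc (0 : ℝ) 1 ∧ ∀ j < k, |φ^[j] x - φ^[j] y| ≤ ε} ≤
        ENNReal.ofReal ((2 / s) ^ k) := by
  choose δ hδ hvol using hφ.exists_volume_le hs
  obtain ⟨ε, hε, hball⟩ := lebesgue_number_lemma_of_metric (c := fun x => Metric.ball x (δ x))
    (isCompact_Icc (a := (0 : ℝ)) (b := 1)) (fun x => Metric.isOpen_ball)
    (fun x _ => mem_iUnion.2 ⟨x, Metric.mem_ball_self (hδ x)⟩)
  refine ⟨ε / 2, half_pos hε, fun k => ?_⟩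
  induction k with
  | zero =>
    intro x _
    refine (measure_mono fun y hy => hy.1).trans ?_
    simp
  | succ k ih =>
    intro x hx
    obtain ⟨c, hc⟩ := hball x hx
    refine le_trans (measure_mono ?_) ((hvol c _).trans (le_trans
      (mul_le_mul_right (ih (φ x) (hmaps hx)) _) ?_))
    · rintro y ⟨hy, h⟩
      refine ⟨hc ?_, hmaps hy, fun j hj => ?_⟩
      · have := h 0 k.succ_pos
        rw [Metric.mem_ball, dist_comm, Real.dist_eq]
        exact lt_of_le_of_lt this (half_lt_self hε)
      · simpa [Function.iterate_succ_apply] using h (j + 1) (Nat.succ_lt_succ hj)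
    · rw [← ENNReal.ofReal_mul (by positivity), pow_succ, mul_comm]

end BowenBalls

/-! ### Triangle waves on the interval and their entropy -/

/-- The map `x ↦ triWave (l x)` of the interval. -/
noncomputable def waveMap (l : ℝ) : C(I, I) where
  toFun x := ⟨triWave (l * x), triWave_nonneg _, triWave_le_one _⟩
  continuous_toFun := by
    have := continuous_triWave
    fun_prop

lemma coe_waveMap (l : ℝ) (x : I) : (waveMap l x : ℝ) = triWave (l * x) := rfl

lemma dist_waveMap_le {l : ℝ} (hl : 0 ≤ l) (x y : I) :
    dist (waveMap l x) (waveMap l y) ≤ l * dist x y := by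
  rw [Subtype.dist_eq, Subtype.dist_eq, Real.dist_eq, Real.dist_eq]
  refine (abs_triWave_sub_le _ _).trans (le_of_eq ?_)
  rw [← mul_sub, abs_mul, abs_of_nonneg hl]

lemma waveMap_zero (l : ℝ) : waveMap l 0 = 0 :=
  Subtype.ext (by simp [coe_waveMap, triWave])

/-- Odd slopes are used because a map placed on the left half of a join must fix 1. -/
lemma waveMap_odd_one (k : ℕ) : waveMap (2 * k + 1) 1 = 1 := by
  refine Subtype.ext ?_
  rw [coe_waveMap, triWave_eq (z := k)] <;> simp

lemma coe_waveMap_iterate (l : ℝ) (x : I) (n : ℕ) :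
    (((waveMap l)^[n] x : I) : ℝ) = (fun t => triWave (l * t))^[n] x := by
  induction n generalizing x with
  | zero => rfl
  | succ n ih => rw [Function.iterate_succ_apply, ih, Function.iterate_succ_apply]; rfl

lemma dist_iterate_le {T : I → I} {l : ℝ} (hl : 0 ≤ l)
    (hT : ∀ x y, dist (T x) (T y) ≤ l * dist x y) (x y : I) (n : ℕ) :
    dist (T^[n] x) (T^[n] y) ≤ l ^ n * dist x y := by
  induction n with
  | zero => simp
  | succ n ih =>
    rw [Function.iterate_succ_apply', Function.iterate_succ_apply', pow_succ', mul_assoc]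
    exact (hT _ _).trans (by gcongr)

/-- An interval map with Lipschitz constant `l ≥ 1` has entropy at most `log l`. -/
lemma entropyBound_of_lipschitz {T : I → I} {l : ℝ} (hl : 1 ≤ l)
    (hT : ∀ x y, dist (T x) (T y) ≤ l * dist x y) :
    EntropyBound (fun x => {T x}) (Real.log l) := by
  refine EntropyBound.of_code fun ε hε B hB => ⟨1 / ε + 1, fun n => ?_⟩
  have hl0 : 0 < l := by linarith
  -- With this mesh the cell of the initial point determines the whole `n`-orbit up to ε.
  have hε' : 0 < ε / l ^ n := by positivity
  refine ⟨ℕ, Finset.range (⌊1 / (ε / l ^ n)⌋₊ + 1),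
    fun x => if h : 0 < n then ⌊(x ⟨0, h⟩ : ℝ) / (ε / l ^ n)⌋₊ else 0, ?_, ?_, ?_⟩
  · rw [Finset.card_range]
    push_cast
    have h1 : l ^ n ≤ Real.exp (B * n) := by
      rw [mul_comm, Real.exp_nat_mul]
      gcongr
      rw [← Real.log_le_iff_le_exp hl0]
      exact hB.le
    have h2 := Nat.floor_le (a := 1 / (ε / l ^ n)) (by positivity)
    have h3 : 1 / (ε / l ^ n) = 1 / ε * l ^ n := by field_simp
    have h4 : 1 ≤ l ^ n := one_le_pow₀ hl
    calc (⌊1 / (ε / l ^ n)⌋₊ : ℝ) + 1 ≤ 1 / ε * l ^ n + l ^ n := by linarith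
      _ = (1 / ε + 1) * l ^ n := by ring
      _ ≤ _ := by gcongr
  · intro x _
    rw [Finset.mem_range, Nat.lt_succ_iff]
    split_ifs with h
    · exact floor_div_le_floor_one_div hε' _
    · exact Nat.zero_le _
  · intro x hx y hy h i
    simp only [dif_pos i.pos] at h
    have h1 := dist_le_of_floor_div_eq hε' h
    rw [eq_iterate_of_mem_setOrbits hx i.pos, eq_iterate_of_mem_setOrbits hy i.pos]
    refine (dist_iterate_le hl0.le hT _ _ _).trans ?_
    calc _ ≤ l ^ n * (ε / l ^ n) := by
          gcongr
          exact i.2.le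
      _ = ε := by field_simp

/-- If separated sets have bounded cardinality, a largest one is spanning. -/
lemma exists_separated_spanning {X : Type*} [MetricSpace X] (F : X → Set X) (n : ℕ) {ε : ℝ}
    (hε : 0 ≤ ε) (h : maxSeparated F n ε < ⊤) :
    ∃ S : Set (Fin n → X), S.Finite ∧ S.encard = maxSeparated F n ε ∧ S ⊆ setOrbits F n ∧
      ∀ z ∈ setOrbits F n, ∃ x ∈ S, ∀ i, dist (x i) (z i) ≤ ε := by
  have h' : ⨆ S : {S : Set (Fin n → X) // IsOrbitSeparated F n ε S}, S.1.encard
      = maxSeparated F n ε := by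
    rw [maxSeparated, iSup_subtype]
  have : Nonempty {S : Set (Fin n → X) // IsOrbitSeparated F n ε S} :=
    ⟨∅, empty_subset _, by simp⟩
  obtain ⟨⟨S, hS⟩, hmax⟩ := ENat.exists_eq_iSup_of_lt_top (h' ▸ h)
  rw [h'] at hmax
  have hmax : S.encard = maxSeparated F n ε := hmax
  have hfin : S.Finite := encard_lt_top_iff.1 (hmax ▸ h)
  refine ⟨S, hfin, hmax, hS.1, fun z hz => ?_⟩
  by_contra! hcon
  have hzS : z ∉ S := fun hzS => by
    obtain ⟨i, hi⟩ := hcon z hzS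
    rw [dist_self] at hi
    exact hε.not_gt hi
  have hins : IsOrbitSeparated F n ε (insert z S) := by
    refine ⟨insert_subset hz hS.1, ?_⟩
    rintro x (rfl | hx) y (rfl | hy) hxy
    · exact absurd rfl hxy
    · obtain ⟨i, hi⟩ := hcon y hy
      exact ⟨i, dist_comm (y i) (x i) ▸ hi⟩
    · exact hcon x hx
    · exact hS.2 x hx y hy hxy
  have h1 := hins.encard_le
  rw [encard_insert_of_notMem hzS, ← hmax, hfin.encard_eq_coe_toFinset_card] at h1
  have : hfin.toFinset.card + 1 ≤ hfin.toFinset.card := by exact_mod_cast h1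
  omega

/-- Bowen balls around the initial points of a largest separated set cover [0,1], and each has
measure at most `(2 / l ^ m) ^ k` by the estimate for the `m`-th iterate. Iterating first makes the
loss of a factor 2 occur only once every `m` steps. -/
lemma exists_pow_le_maxSeparated_waveMap {l : ℝ} (hl : 1 ≤ l) (m : ℕ) (hm : 0 < m) :
    ∃ ε > 0, ∀ k : ℕ, 0 < k → ENNReal.ofReal ((l ^ m / 2) ^ k) ≤
      maxSeparated (fun x => {waveMap l x}) (m * k) ε := by
  have hl0 : 0 < l := by linarith
  set τ : ℝ → ℝ := fun t => triWave (l * t)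
  have hmaps : MapsTo τ (Icc 0 1) (Icc 0 1) := fun _ _ => ⟨triWave_nonneg _, triWave_le_one _⟩
  obtain ⟨ε, hε, hvol⟩ := ((locallyAffine_triWave_mul hl0).iterate hl0 m).exists_volume_bowen_le
    (pow_pos hl0 m) (hmaps.iterate m)
  refine ⟨ε, hε, fun k hk => ?_⟩
  rcases (le_top (a := maxSeparated (fun x => {waveMap l x}) (m * k) ε)).eq_or_lt with htop | htop
  · simp [htop]
  obtain ⟨S, hfin, hcard, hSo, hspan⟩ := exists_separated_spanning _ _ hε.le htop
  have hpos : 0 < m * k := Nat.mul_pos hm hk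
  have hcover : Icc (0 : ℝ) 1 ⊆ ⋃ x ∈ hfin.toFinset, {y | y ∈ Icc (0 : ℝ) 1 ∧ ∀ j < k,
      |(τ^[m])^[j] (x ⟨0, hpos⟩ : ℝ) - (τ^[m])^[j] y| ≤ ε} := by
    intro y hy
    obtain ⟨x, hx, hd⟩ := hspan _ (iterate_mem_setOrbits (waveMap l) (m * k) ⟨y, hy⟩)
    refine mem_iUnion₂.2 ⟨x, hfin.mem_toFinset.2 hx, hy, fun j hj => ?_⟩
    have := hd ⟨m * j, Nat.mul_lt_mul_of_pos_left hj hm⟩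
    rw [eq_iterate_of_mem_setOrbits (hSo hx) hpos, Subtype.dist_eq, Real.dist_eq,
      coe_waveMap_iterate, coe_waveMap_iterate] at this
    rwa [← Function.iterate_mul]
  have h1 := (MeasureTheory.measure_mono (μ := MeasureTheory.volume) hcover).trans
    ((MeasureTheory.measure_biUnion_finset_le _ _).trans
      (Finset.sum_le_card_nsmul _ _ _ fun x _ => hvol k _ (x ⟨0, hpos⟩).2))
  rw [Real.volume_Icc, sub_zero, ENNReal.ofReal_one, nsmul_eq_mul, ← ENNReal.ofReal_natCast,
    ← ENNReal.ofReal_mul (by positivity), ENNReal.one_le_ofReal] at h1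
  rw [← hcard, hfin.encard_eq_coe_toFinset_card]
  have h2 : (l ^ m / 2) ^ k ≤ hfin.toFinset.card := by
    have h3 : (l ^ m / 2) ^ k * (2 / l ^ m) ^ k = 1 := by
      rw [← mul_pow]
      field_simp
      simp
    have h4 : (0 : ℝ) < (l ^ m / 2) ^ k := by positivity
    calc (l ^ m / 2) ^ k = (l ^ m / 2) ^ k * 1 := (mul_one _).symm
      _ ≤ (l ^ m / 2) ^ k * (hfin.toFinset.card * (2 / l ^ m) ^ k) := by gcongr
      _ = hfin.toFinset.card * ((l ^ m / 2) ^ k * (2 / l ^ m) ^ k) := by ring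
      _ = _ := by rw [h3, mul_one]
  refine (ENNReal.ofReal_le_ofReal h2).trans ?_
  simp

lemma log_le_mapEntropy_waveMap {l : ℝ} (hl : 1 ≤ l) :
    ((Real.log l : ℝ) : EReal) ≤ mapEntropy (waveMap l) := by
  have hl0 : 0 < l := by linarith
  refine EReal.ge_of_forall_gt_iff_ge.1 fun B hB => ?_
  have hB : B < Real.log l := by exact_mod_cast hB
  -- The growth rate obtained from the `m`-th iterate is `log l - log 2 / m`, which must exceed `B`.
  obtain ⟨m, hm⟩ := exists_nat_gt (Real.log 2 / (Real.log l - B))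
  have hm0 : (0 : ℝ) < m := lt_of_le_of_lt
    (div_nonneg (Real.log_nonneg one_le_two) (sub_pos.2 hB).le) hm
  rw [div_lt_iff₀ (sub_pos.2 hB)] at hm
  have hm1 : 0 < m := by exact_mod_cast hm0
  obtain ⟨ε, hε, h⟩ := exists_pow_le_maxSeparated_waveMap hl m hm1
  refine le_setEntropy_of_frequently hε (frequently_atTop.2 fun a => ?_)
  refine ⟨m * (a + 1), by nlinarith, le_trans ?_ (h (a + 1) a.succ_pos)⟩
  refine ENNReal.ofReal_le_ofReal ?_
  rw [show B * ((m * (a + 1) : ℕ) : ℝ) = ((a + 1 : ℕ) : ℝ) * (B * m) by push_cast; ring,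
    Real.exp_nat_mul]
  gcongr
  rw [← Real.le_log_iff_exp_le (by positivity), Real.log_div (by positivity) two_ne_zero,
    Real.log_pow]
  linarith

/-! ### Joining two interval maps at a common fixed point -/

/-- The map of the interval collapsing its right half. -/
noncomputable def collapseRight : C(I, I) where
  toFun x := ⟨min (2 * x) 1, le_min (by linarith [x.2.1]) zero_le_one, min_le_right _ _⟩
  continuous_toFun := by fun_prop

/-- The map of the interval collapsing its left half. -/
noncomputable def collapseLeft : C(I, I) where
  toFun x := ⟨max (2 * x - 1) 0, le_max_right _ _, max_le (by linarith [x.2.2]) zero_le_one⟩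
  continuous_toFun := by fun_prop

/-- The map that acts as `p` on the left half and as `q` on the right half of the interval,
provided that `p 1 = 1` and `q 0 = 0`. -/
noncomputable def joinMap (p q : C(I, I)) : C(I, I) where
  toFun x := ⟨((p (collapseRight x) : ℝ) + q (collapseLeft x)) / 2,
    by linarith [(p (collapseRight x)).2.1, (q (collapseLeft x)).2.1],
    by linarith [(p (collapseRight x)).2.2, (q (collapseLeft x)).2.2]⟩
  continuous_toFun := by fun_prop

lemma coe_collapseRight (x : I) : (collapseRight x : ℝ) = min (2 * (x : ℝ)) 1 := rfl

lemma coe_collapseLeft (x : I) : (collapseLeft x : ℝ) = max (2 * (x : ℝ) - 1) 0 := rfl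

lemma coe_joinMap (p q : C(I, I)) (x : I) :
    (joinMap p q x : ℝ) = ((p (collapseRight x) : ℝ) + q (collapseLeft x)) / 2 := rfl

lemma collapse_cases (x : I) : collapseLeft x = 0 ∨ collapseRight x = 1 := by
  rcases le_total (2 * (x : ℝ)) 1 with h | h
  · exact Or.inl (Subtype.ext (max_eq_right (by linarith)))
  · exact Or.inr (Subtype.ext (min_eq_right h))

lemma coe_eq_collapse (x : I) : (x : ℝ) = ((collapseRight x : ℝ) + collapseLeft x) / 2 := by
  rw [coe_collapseRight, coe_collapseLeft]
  rcases le_total (2 * (x : ℝ)) 1 with h | h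
  · rw [min_eq_left h, max_eq_right (by linarith)]; ring
  · rw [min_eq_right h, max_eq_left (by linarith)]; ring

lemma collapseRight_surjective : Function.Surjective collapseRight := fun y =>
  ⟨⟨y / 2, by linarith [y.2.1], by linarith [y.2.2]⟩, Subtype.ext <| by
    rw [coe_collapseRight, min_eq_left (by linarith [y.2.2])]; simp only; ring⟩

lemma collapseLeft_surjective : Function.Surjective collapseLeft := fun y =>
  ⟨⟨(1 + y) / 2, by linarith [y.2.1], by linarith [y.2.2]⟩, Subtype.ext <| by
    rw [coe_collapseLeft, max_eq_left (by simp only; linarith [y.2.1])]; simp only; ring⟩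

section Join

variable {p q : C(I, I)}

/-- Left of the midpoint only the `p` term varies; right of it `p` is evaluated at its fixed point
1. So each half is a factor of the join. -/
lemma collapseRight_joinMap (hp : p 1 = 1) (hq : q 0 = 0) (x : I) :
    collapseRight (joinMap p q x) = p (collapseRight x) := by
  refine Subtype.ext ?_
  rw [coe_collapseRight, coe_joinMap]
  rcases collapse_cases x with h | h
  · rw [h, hq, min_eq_left] <;> simp only [Icc.coe_zero] <;>
      linarith [(p (collapseRight x)).2.2]
  · rw [h, hp, min_eq_right] <;> simp only [Icc.coe_one]
    linarith [(q (collapseLeft x)).2.1]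

lemma collapseLeft_joinMap (hp : p 1 = 1) (hq : q 0 = 0) (x : I) :
    collapseLeft (joinMap p q x) = q (collapseLeft x) := by
  refine Subtype.ext ?_
  rw [coe_collapseLeft, coe_joinMap]
  rcases collapse_cases x with h | h
  · rw [h, hq, max_eq_right] <;> simp only [Icc.coe_zero]
    linarith [(p (collapseRight x)).2.2]
  · rw [h, hp, max_eq_left] <;> simp only [Icc.coe_one] <;>
      linarith [(q (collapseLeft x)).2.1]

lemma joinMap_surjective (hp : p 1 = 1) (hq : q 0 = 0) (hps : Function.Surjective p)
    (hqs : Function.Surjective q) : Function.Surjective (joinMap p q) := by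
  intro y
  rcases collapse_cases y with h | h
  · obtain ⟨s, hs⟩ := hps (collapseRight y)
    refine ⟨⟨s / 2, by linarith [s.2.1], by linarith [s.2.2]⟩, Subtype.ext ?_⟩
    have h1 : collapseRight ⟨s / 2, by linarith [s.2.1], by linarith [s.2.2]⟩ = s :=
      Subtype.ext (by rw [coe_collapseRight, min_eq_left] <;> simp only <;> linarith [s.2.2])
    have h2 : collapseLeft ⟨s / 2, by linarith [s.2.1], by linarith [s.2.2]⟩ = 0 :=
      Subtype.ext (by rw [coe_collapseLeft, max_eq_right] <;> simp only [Icc.coe_zero]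
                      linarith [s.2.2])
    rw [coe_joinMap, h1, h2, hs, hq, coe_eq_collapse y, h]
  · obtain ⟨s, hs⟩ := hqs (collapseLeft y)
    refine ⟨⟨(1 + s) / 2, by linarith [s.2.1], by linarith [s.2.2]⟩, Subtype.ext ?_⟩
    have h1 : collapseRight ⟨(1 + s) / 2, by linarith [s.2.1], by linarith [s.2.2]⟩ = 1 :=
      Subtype.ext (by rw [coe_collapseRight, min_eq_right] <;> simp only [Icc.coe_one]
                      linarith [s.2.1])
    have h2 : collapseLeft ⟨(1 + s) / 2, by linarith [s.2.1], by linarith [s.2.2]⟩ = s :=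
      Subtype.ext (by rw [coe_collapseLeft, max_eq_left] <;> simp only <;> linarith [s.2.1])
    rw [coe_joinMap, h1, h2, hs, hp, coe_eq_collapse y, h]

lemma dist_eq_of_collapseLeft_eq {x y : I} (h : collapseLeft x = collapseLeft y) :
    dist x y = dist (collapseRight x) (collapseRight y) / 2 := by
  rw [Subtype.dist_eq, Subtype.dist_eq, Real.dist_eq, Real.dist_eq, coe_eq_collapse x,
    coe_eq_collapse y, h, ← sub_div, add_sub_add_right_eq_sub, abs_div, abs_two]

lemma dist_eq_of_collapseRight_eq {x y : I} (h : collapseRight x = collapseRight y) :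
    dist x y = dist (collapseLeft x) (collapseLeft y) / 2 := by
  rw [Subtype.dist_eq, Subtype.dist_eq, Real.dist_eq, Real.dist_eq, coe_eq_collapse x,
    coe_eq_collapse y, h, ← sub_div, add_sub_add_left_eq_sub, abs_div, abs_two]

/-- An entropy bound for a set-valued map preserving both halves of the interval follows from
bounds on both halves. -/
lemma EntropyBound.of_halves {F F₁ F₂ : I → Set I} {A : ℝ} (h₁ : EntropyBound F₁ A)
    (h₂ : EntropyBound F₂ A) (hF₁ : ∀ x, ∀ y ∈ F x, collapseRight y ∈ F₁ (collapseRight x))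
    (hF₂ : ∀ x, ∀ y ∈ F x, collapseLeft y ∈ F₂ (collapseLeft x)) (h1 : F₁ 1 ⊆ {1})
    (h0 : F₂ 0 ⊆ {0}) : EntropyBound F A := by
  intro ε hε B hB
  obtain ⟨C₁, hC₁⟩ := h₁ ε hε B hB
  obtain ⟨C₂, hC₂⟩ := h₂ ε hε B hB
  refine ⟨C₁ + C₂, fun n S hS => ?_⟩
  set S₁ := {x ∈ S | ∀ i, collapseLeft (x i) = 0}
  set S₂ := {x ∈ S | ∀ i, collapseRight (x i) = 1}
  -- `h0` and `h1` keep an orbit in the half that contains its first point.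
  have hsub : S ⊆ S₁ ∪ S₂ := by
    intro x hx
    rcases Nat.eq_zero_or_pos n with rfl | hn
    · exact Or.inl ⟨hx, fun i => i.elim0⟩
    · rcases collapse_cases (x ⟨0, hn⟩) with h | h
      · refine Or.inl ⟨hx, fun ⟨i, hi⟩ => ?_⟩
        induction i with
        | zero => exact h
        | succ i ih =>
          have := hF₂ _ _ (hS.1 hx i hi)
          rw [ih (Nat.lt_of_succ_lt hi)] at this
          exact h0 this
      · refine Or.inr ⟨hx, fun ⟨i, hi⟩ => ?_⟩
        induction i with
        | zero => exact h
        | succ i ih =>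
          have := hF₁ _ _ (hS.1 hx i hi)
          rw [ih (Nat.lt_of_succ_lt hi)] at this
          exact h1 this
  have hS₁ : IsOrbitSeparated F n ε S₁ :=
    ⟨fun x hx => hS.1 hx.1, fun x hx y hy => hS.2 x hx.1 y hy.1⟩
  have hS₂ : IsOrbitSeparated F n ε S₂ :=
    ⟨fun x hx => hS.1 hx.1, fun x hx y hy => hS.2 x hx.1 y hy.1⟩
  obtain ⟨hi₁, hs₁⟩ := hS₁.image (G := F₁) hε.le (fun x i => collapseRight (x i))
    (fun x hx i hi => hF₁ _ _ (hS.1 hx.1 i hi)) (fun x hx y hy i h => by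
      rw [dist_eq_of_collapseLeft_eq ((hx.2 i).trans (hy.2 i).symm)]
      linarith [dist_nonneg (x := collapseRight (x i)) (y := collapseRight (y i))])
  obtain ⟨hi₂, hs₂⟩ := hS₂.image (G := F₂) hε.le (fun x i => collapseLeft (x i))
    (fun x hx i hi => hF₂ _ _ (hS.1 hx.1 i hi)) (fun x hx y hy i h => by
      rw [dist_eq_of_collapseRight_eq ((hx.2 i).trans (hy.2 i).symm)]
      linarith [dist_nonneg (x := collapseLeft (x i)) (y := collapseLeft (y i))])
  obtain ⟨hf₁, hc₁⟩ := hC₁ n _ hs₁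
  obtain ⟨hf₂, hc₂⟩ := hC₂ n _ hs₂
  rw [hi₁.ncard_image] at hc₁
  rw [hi₂.ncard_image] at hc₂
  have hfin := (hf₁.of_finite_image hi₁).union (hf₂.of_finite_image hi₂)
  refine ⟨hfin.subset hsub, ?_⟩
  have h3 : (S.ncard : ℝ) ≤ S₁.ncard + S₂.ncard := by
    exact_mod_cast (ncard_le_ncard hsub hfin).trans (ncard_union_le _ _)
  rw [add_mul]
  linarith

lemma entropyBound_joinMap {A : ℝ} (hp : p 1 = 1) (hq : q 0 = 0)
    (h₁ : EntropyBound (fun x => {p x}) A) (h₂ : EntropyBound (fun x => {q x}) A) :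
    EntropyBound (fun x => {joinMap p q x}) A := by
  refine h₁.of_halves h₂ ?_ ?_ (by simp [hp]) (by simp [hq])
  · rintro x _ rfl
    exact collapseRight_joinMap hp hq x
  · rintro x _ rfl
    exact collapseLeft_joinMap hp hq x

lemma mapEntropy_left_le_joinMap (hp : p 1 = 1) (hq : q 0 = 0) :
    mapEntropy p ≤ mapEntropy (joinMap p q) :=
  mapEntropy_le_of_semiconj (collapseRight_joinMap hp hq) collapseRight_surjective
    (CompactSpace.uniformContinuous_of_continuous collapseRight.continuous)

end Join

/-! ### Inverse limits -/

namespace IntervalInverseLimit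

variable {f : ℕ → C(I, I)}

lemma dist_coord_le (x y : IntervalInverseLimit f) (i : ℕ) :
    dist (x.coord i) (y.coord i) ≤ 2 ^ i * dist x y := by
  have : dist (x.coord i) (y.coord i) / 2 ^ i ≤ dist x y :=
    (summable_dist x y).le_tsum i fun j _ => by positivity
  rwa [div_le_iff₀' (by positivity)] at this

/-- Both the first `K` terms and the tail are bounded by geometric series, as coordinates differ by
at most 1. -/
lemma dist_le_of_coord {η : ℝ} (hη : 0 ≤ η) (x y : IntervalInverseLimit f) (K : ℕ)
    (h : ∀ i < K, dist (x.coord i) (y.coord i) ≤ η) : dist x y ≤ 2 * η + 2 * (1 / 2) ^ K := by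
  have hs := summable_dist x y
  have hle : ∀ i, dist (x.coord i) (y.coord i) ≤ 1 := fun i => by
    rw [Subtype.dist_eq, Real.dist_eq, abs_le]
    have h1 := (x.coord i).2
    have h2 := (y.coord i).2
    constructor <;> linarith [h1.1, h1.2, h2.1, h2.2]
  change ∑' i, _ ≤ _
  rw [← hs.sum_add_tsum_nat_add K]
  refine add_le_add ?_ ?_
  · calc ∑ i ∈ Finset.range K, dist (x.coord i) (y.coord i) / 2 ^ i
        ≤ ∑ i ∈ Finset.range K, η * (1 / 2) ^ i := by
          refine Finset.sum_le_sum fun i hi => ?_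
          rw [one_div, inv_pow, ← div_eq_mul_inv]
          gcongr
          exact h i (Finset.mem_range.1 hi)
      _ ≤ ∑' i, η * (1 / 2) ^ i :=
          (summable_geometric_two.mul_left η).sum_le_tsum _ fun i _ => by positivity
      _ = 2 * η := by rw [tsum_mul_left, tsum_geometric_two, mul_comm]
  · calc ∑' i, dist (x.coord (i + K)) (y.coord (i + K)) / 2 ^ (i + K)
        ≤ ∑' i : ℕ, (1 / 2) ^ K * (1 / 2 : ℝ) ^ i := by
          refine ((summable_nat_add_iff K).2 hs).tsum_le_tsum (fun i => ?_)
            (summable_geometric_two.mul_left _)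
          rw [← pow_add, one_div, inv_pow, ← one_div, add_comm K]
          gcongr
          exact hle _
      _ = _ := by rw [tsum_mul_left, tsum_geometric_two, mul_comm]

lemma exists_dist_coord_le (K : ℕ) {ε : ℝ} (hε : 0 < ε) : ∃ δ > 0, ∀ x y : IntervalInverseLimit f,
    dist (x.coord K) (y.coord K) ≤ δ → ∀ i ≤ K, dist (x.coord i) (y.coord i) ≤ ε := by
  induction K with
  | zero =>
    refine ⟨ε, hε, fun x y h i hi => ?_⟩
    rwa [Nat.le_zero.1 hi]
  | succ K ih =>
    obtain ⟨δ, hδ, h⟩ := ih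
    obtain ⟨δ', hδ', h'⟩ := Metric.uniformContinuous_iff.1
      (CompactSpace.uniformContinuous_of_continuous (f K).continuous) δ hδ
    refine ⟨min ε (δ' / 2), by positivity, fun x y hxy i hi => ?_⟩
    rcases hi.eq_or_lt with rfl | hi
    · exact hxy.trans (min_le_left _ _)
    · refine h x y ?_ i (Nat.lt_succ_iff.1 hi)
      rw [← x.bonding, ← y.bonding]
      exact (h' ((hxy.trans (min_le_right _ _)).trans_lt (half_lt_self hδ'))).le

/-- Later coordinates are chosen by right inverses of the bonding maps, earlier ones are forced. -/
lemma exists_coord_eq (f : ℕ → C(I, I)) (hf : ∀ i, Function.Surjective (f i)) (k : ℕ) (w : I) :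
    ∃ x : IntervalInverseLimit f, x.coord k = w := by
  induction k generalizing f with
  | zero =>
    choose r hr using fun i => (hf i).hasRightInverse
    exact ⟨⟨fun n => Nat.rec w (fun i y => r i y) n, fun i => hr i _⟩, rfl⟩
  | succ k ih =>
    obtain ⟨x, hx⟩ := ih (fun i => f (i + 1)) fun i => hf (i + 1)
    refine ⟨⟨fun n => Nat.casesOn n (f 0 (x.coord 0)) x.coord, fun i => ?_⟩, hx⟩
    cases i with
    | zero => rfl
    | succ i => exact x.bonding i

end IntervalInverseLimit

/-! ### Towers of interval maps and their diagonal systems -/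

section Tower

/-- The set-valued map `α ∘ D ∘ α⁻¹`. -/
def foldRel (α D : C(I, I)) (x : I) : Set I := {y | ∃ s, α s = x ∧ α (D s) = y}

/-- The maps obtained from `D` by successively adding the maps `E i` on a new left half. -/
noncomputable def towerMap (D : C(I, I)) (E : ℕ → C(I, I)) : ℕ → C(I, I)
  | 0 => D
  | i + 1 => joinMap (E i) (towerMap D E i)

/-- The maps folding only the newest half by `α i`. -/
noncomputable def towerFold (α : ℕ → C(I, I)) : ℕ → C(I, I)
  | 0 => ContinuousMap.id I
  | i + 1 => joinMap (α i) (ContinuousMap.id I)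

/-- The bonding maps of the diagonal system of a tower. -/
noncomputable def towerBonding (α : ℕ → C(I, I)) (i : ℕ) : C(I, I) :=
  (towerFold α i).comp collapseLeft

/-- The diagonal maps of the diagonal system of a tower. -/
noncomputable def towerDiagonal (D : C(I, I)) (E α : ℕ → C(I, I)) (i : ℕ) : C(I, I) :=
  (towerFold α i).comp ((towerMap D E i).comp collapseLeft)

variable {D : C(I, I)} {E α : ℕ → C(I, I)}

lemma towerMap_zero (hD : D 0 = 0) (hE : ∀ i, E i 0 = 0) (i : ℕ) : towerMap D E i 0 = 0 := by
  cases i with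
  | zero => exact hD
  | succ i =>
    have h0 : collapseRight 0 = 0 := Subtype.ext (by simp [coe_collapseRight])
    have h0' : collapseLeft 0 = 0 := Subtype.ext (by simp [coe_collapseLeft])
    refine Subtype.ext ?_
    rw [towerMap, coe_joinMap, h0, h0', hE, towerMap_zero hD hE i]
    simp

/-- The fold moves points only within the newest half, which the next bonding map collapses. This is
what hides it from the diagonal map. -/
lemma collapseLeft_towerFold_succ (hα : ∀ i, α i 1 = 1) (i : ℕ) (x : I) :
    collapseLeft (towerFold α (i + 1) x) = collapseLeft x :=
  collapseLeft_joinMap (hα i) rfl x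

lemma collapseLeft_towerMap_succ (hD : D 0 = 0) (hE : ∀ i, E i 0 = 0) (hE1 : ∀ i, E i 1 = 1)
    (i : ℕ) (x : I) :
    collapseLeft (towerMap D E (i + 1) x) = towerMap D E i (collapseLeft x) :=
  collapseLeft_joinMap (hE1 i) (towerMap_zero hD hE i) x

lemma tower_comm (hD : D 0 = 0) (hE : ∀ i, E i 0 = 0) (hE1 : ∀ i, E i 1 = 1)
    (hα : ∀ i, α i 1 = 1) (i : ℕ) :
    (towerBonding α i).comp (towerDiagonal D E α (i + 1)) =
      (towerDiagonal D E α i).comp (towerBonding α (i + 1)) := by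
  ext1 x
  simp only [towerBonding, towerDiagonal, ContinuousMap.comp_apply]
  rw [collapseLeft_towerFold_succ hα, collapseLeft_towerFold_succ hα,
    collapseLeft_towerMap_succ hD hE hE1]

lemma towerBonding_surjective (hα : ∀ i, α i 1 = 1) (hs : ∀ i, Function.Surjective (α i)) (i : ℕ) :
    Function.Surjective (towerBonding α i) := by
  have hid : Function.Surjective (ContinuousMap.id I) := Function.surjective_id
  have : Function.Surjective (towerFold α i) := by
    cases i with
    | zero => exact hid
    | succ i => exact joinMap_surjective (hα i) rfl (hs i) hid
  exact this.comp collapseLeft_surjective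

/-- Both maps factor through the surjection `collapseLeft`, which therefore cancels. -/
lemma compInv_tower (i : ℕ) :
    compInv (towerDiagonal D E α i) (towerBonding α i) =
      foldRel (towerFold α i) (towerMap D E i) := by
  funext x
  ext y
  constructor
  · rintro ⟨t, ht, rfl⟩
    exact ⟨collapseLeft t, ht, rfl⟩
  · rintro ⟨s, rfl, rfl⟩
    obtain ⟨t, rfl⟩ := collapseLeft_surjective s
    exact ⟨t, rfl, rfl⟩

lemma foldRel_id (D : C(I, I)) : foldRel (ContinuousMap.id I) D = fun x => {D x} := by
  funext x
  ext y
  simp [foldRel, eq_comm]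

/-- The projection of the inverse limit of a tower to its `i`-th deterministic level. -/
noncomputable def towerProj (α : ℕ → C(I, I)) (i : ℕ)
    (x : IntervalInverseLimit (towerBonding α)) : I :=
  collapseLeft (x.coord (i + 1))

lemma towerProj_semiconj (hD : D 0 = 0) (hE : ∀ i, E i 0 = 0) (hE1 : ∀ i, E i 1 = 1)
    (hα : ∀ i, α i 1 = 1)
    (h : ∀ i, (towerBonding α i).comp (towerDiagonal D E α (i + 1)) =
      (towerDiagonal D E α i).comp (towerBonding α (i + 1))) (i : ℕ) :
    Function.Semiconj (towerProj α i) (diagonalMap (towerBonding α) (towerDiagonal D E α) h)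
      (towerMap D E i) := by
  intro x
  simp only [towerProj, diagonalMap]
  rw [← x.bonding (i + 1)]
  simp only [towerBonding, towerDiagonal, ContinuousMap.comp_apply]
  rw [collapseLeft_towerFold_succ hα, collapseLeft_towerFold_succ hα,
    collapseLeft_towerMap_succ hD hE hE1]

lemma mapEntropy_towerMap_le_diagonalMap (hD : D 0 = 0) (hE : ∀ i, E i 0 = 0)
    (hE1 : ∀ i, E i 1 = 1) (hα : ∀ i, α i 1 = 1) (hs : ∀ i, Function.Surjective (α i))
    (h : ∀ i, (towerBonding α i).comp (towerDiagonal D E α (i + 1)) =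
      (towerDiagonal D E α i).comp (towerBonding α (i + 1))) (i : ℕ) :
    mapEntropy (towerMap D E i) ≤
      mapEntropy (diagonalMap (towerBonding α) (towerDiagonal D E α) h) := by
  refine mapEntropy_le_of_semiconj (towerProj_semiconj hD hE hE1 hα h i) ?_ ?_
  · intro z
    obtain ⟨w, rfl⟩ := collapseLeft_surjective z
    obtain ⟨x, hx⟩ := IntervalInverseLimit.exists_coord_eq _ (towerBonding_surjective hα hs)
      (i + 1) w
    exact ⟨x, congrArg collapseLeft hx⟩
  · refine (CompactSpace.uniformContinuous_of_continuous collapseLeft.continuous).comp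
      (LipschitzWith.of_dist_le_mul (K := 2 ^ (i + 1)) fun x y => ?_).uniformContinuous
    simpa using IntervalInverseLimit.dist_coord_le x y (i + 1)

/-- The projection to level `K` determines coordinate `K`, hence all earlier ones by uniform
continuity, while the later coordinates hardly contribute to the metric. -/
lemma entropyBound_diagonalMap_tower {A : ℝ} (hD : D 0 = 0) (hE : ∀ i, E i 0 = 0)
    (hE1 : ∀ i, E i 1 = 1) (hα : ∀ i, α i 1 = 1)
    (h : ∀ i, (towerBonding α i).comp (towerDiagonal D E α (i + 1)) =
      (towerDiagonal D E α i).comp (towerBonding α (i + 1)))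
    (hA : ∀ i, EntropyBound (fun x => {towerMap D E i x}) A) :
    EntropyBound (fun x => {diagonalMap (towerBonding α) (towerDiagonal D E α) h x}) A := by
  refine EntropyBound.of_approx (Y := I) fun ε hε => ?_
  -- The first coordinates and the tail then contribute at most `ε / 2` each.
  obtain ⟨K, hK⟩ := exists_pow_lt_of_lt_one (show 0 < ε / 4 by positivity)
    (show (1 / 2 : ℝ) < 1 by norm_num)
  obtain ⟨δ, hδ, hδε⟩ := IntervalInverseLimit.exists_dist_coord_le (f := towerBonding α) K
    (show 0 < ε / 4 by positivity)
  obtain ⟨δ', hδ', hd⟩ := Metric.uniformContinuous_iff.1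
    (CompactSpace.uniformContinuous_of_continuous (towerFold α K).continuous) δ hδ
  refine ⟨fun x => {towerMap D E K x}, towerProj α K, δ' / 2, hA K, half_pos hδ', ?_, ?_⟩
  · rintro x _ rfl
    exact towerProj_semiconj hD hE hE1 hα h K x
  · intro x y hxy
    have h1 : dist (x.coord K) (y.coord K) ≤ δ := by
      rw [← x.bonding, ← y.bonding]
      exact (hd (hxy.trans_lt (half_lt_self hδ'))).le
    have h2 := IntervalInverseLimit.dist_le_of_coord (by positivity) x y K
      fun i hi => hδε x y h1 i hi.le
    linarith

/-- The right half carries the single-valued map of the previous level, the left half the fold.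
Requiring that `α i` take the value 1 only at 1 prevents orbits from passing from the right half to
the left. -/
lemma entropyBound_foldRel_tower {A : ℝ} (hD : D 0 = 0) (hE : ∀ i, E i 0 = 0)
    (hE1 : ∀ i, E i 1 = 1) (hα : ∀ i s, α i s = 1 ↔ s = 1) (i : ℕ)
    (hA : EntropyBound (fun x => {towerMap D E i x}) A)
    (hA' : EntropyBound (foldRel (α i) (E i)) A) :
    EntropyBound (foldRel (towerFold α (i + 1)) (towerMap D E (i + 1))) A := by
  have hα1 : ∀ i, α i 1 = 1 := fun i => (hα i 1).2 rfl
  refine hA'.of_halves hA ?_ ?_ ?_ ?_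
  · rintro _ _ ⟨s, rfl, rfl⟩
    refine ⟨collapseRight s, (collapseRight_joinMap (hα1 i) rfl s).symm, ?_⟩
    rw [towerFold, collapseRight_joinMap (hα1 i) rfl, towerMap,
      collapseRight_joinMap (hE1 i) (towerMap_zero hD hE i)]
  · rintro _ _ ⟨s, rfl, rfl⟩
    rw [collapseLeft_towerFold_succ hα1, collapseLeft_towerFold_succ hα1,
      collapseLeft_towerMap_succ hD hE hE1]
    rfl
  · rintro _ ⟨s, hs, rfl⟩
    rw [(hα i s).1 hs, hE1, hα1]
    rfl
  · rintro _ rfl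
    exact towerMap_zero hD hE i

lemma log_le_setEntropy_foldRel_tower {N : ℕ} (hN : 1 ≤ N) (hD : D 0 = 0) (hE : ∀ i, E i 0 = 0)
    (hE1 : ∀ i, E i 1 = 1) (hα : ∀ i, α i 1 = 1) (i : ℕ) {p : Fin N → I}
    (hp : Function.Injective p) (hF : ∀ j l, p l ∈ foldRel (α i) (E i) (p j)) :
    ((Real.log N : ℝ) : EReal) ≤
      setEntropy (foldRel (towerFold α (i + 1)) (towerMap D E (i + 1))) := by
  have half : ∀ x : I, ∃ y : I, collapseRight y = x ∧ collapseLeft y = 0 := fun x => by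
    refine ⟨⟨x / 2, by linarith [x.2.1], by linarith [x.2.2]⟩, Subtype.ext ?_, Subtype.ext ?_⟩
    · rw [coe_collapseRight, min_eq_left] <;> simp only <;> linarith [x.2.2]
    · rw [coe_collapseLeft, max_eq_right] <;> simp only [Icc.coe_zero]
      linarith [x.2.2]
  choose r hr hl using half
  refine log_le_setEntropy_of_full_graph hN (p := fun j => r (p j))
    (fun j l h => hp (by rw [← hr (p j), ← hr (p l)]; exact congrArg _ h)) fun j l => ?_
  obtain ⟨s, hs, hs'⟩ := hF j l
  have ext : ∀ x y : I, collapseRight x = collapseRight y → collapseLeft x = collapseLeft y →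
      x = y := fun x y h1 h2 => Subtype.ext (by rw [coe_eq_collapse, h1, h2, ← coe_eq_collapse])
  refine ⟨r s, ext _ _ ?_ ?_, ext _ _ ?_ ?_⟩
  · rw [towerFold, collapseRight_joinMap (hα i) rfl, hr, hr, hs]
  · rw [collapseLeft_towerFold_succ hα, hl, hl]
  · rw [towerFold, collapseRight_joinMap (hα i) rfl, towerMap,
      collapseRight_joinMap (hE1 i) (towerMap_zero hD hE i), hr, hr, hs']
  · rw [collapseLeft_towerFold_succ hα, collapseLeft_towerMap_succ hD hE hE1, hl, hl,
      towerMap_zero hD hE]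

end Tower

/-! ### Folding a monotone map -/

/-- A set-valued map that is arbitrary at `1/2`, constant to the right of `1/2` and with values
among `N` points to the left of `1/2` has entropy at most `log N`. -/
lemma entropyBound_of_half {G : I → Set I} {N : ℕ} (hN : 1 ≤ N) {p : Fin N → I}
    (hp : ∀ l, (p l : ℝ) < 1 / 2) (hleft : ∀ x : I, (x : ℝ) < 1 / 2 → ∀ y ∈ G x, ∃ l, y = p l)
    (hright : ∀ x : I, 1 / 2 < (x : ℝ) → ∀ y ∈ G x, y = 1) : EntropyBound G (Real.log N) := by
  classical
  refine EntropyBound.of_code fun ε hε B hB => ?_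
  have hN0 : (0 : ℝ) < N := by exact_mod_cast hN
  set M := ⌊1 / ε⌋₊
  refine ⟨(1 + 1 / (B - Real.log N)) * ((M + 1) * 2), fun n => ?_⟩
  -- The default 0 differs from `1/2`, so the first time away from `1/2` exists and is at most `n`.
  let ext : (Fin n → I) → ℕ → I := fun x i => if h : i < n then x ⟨i, h⟩ else 0
  have hex : ∀ x, ∃ i, (ext x i : ℝ) ≠ 1 / 2 := fun x => ⟨n, by simp [ext]⟩
  let first : (Fin n → I) → ℕ := fun x => Nat.find (hex x)
  let word : (Fin n → I) → Fin n → Fin N :=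
    fun x i => if h : ∃ l, x i = p l then h.choose else ⟨0, hN⟩
  have hword : ∀ x i, (∃ l, x i = p l) → x i = p (word x i) := fun x i h => by
    simp only [word, dif_pos h]
    exact h.choose_spec
  have hext : ∀ x (i : Fin n), ext x i = x i := fun x i => by simp [ext]
  have hle : ∀ x, first x ≤ n := fun x => Nat.find_min' (hex x) (by simp [ext])
  have hsucc : ∀ x ∈ setOrbits G n, ∀ i, i + 1 < n → ext x (i + 1) ∈ G (ext x i) :=
    fun x hx i hi => by
      simp only [ext, dif_pos hi, dif_pos (Nat.lt_of_succ_lt hi)]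
      exact hx i hi
  have hbefore : ∀ x, ∀ i < first x, (ext x i : ℝ) = 1 / 2 := fun x i hi =>
    not_not.1 (Nat.find_min (hex x) hi)
  have hafter_right : ∀ x ∈ setOrbits G n, 1 / 2 < (ext x (first x) : ℝ) →
      ∀ i, first x < i → i < n → ext x i = 1 := by
    intro x hx h i hi
    induction i, hi using Nat.le_induction with
    | base => exact fun hin => hright _ h _ (hsucc x hx _ hin)
    | succ i hi ih =>
      refine fun hin => hright _ ?_ _ (hsucc x hx _ hin)
      rw [ih (Nat.lt_of_succ_lt hin)]
      norm_num
  have hafter_left : ∀ x ∈ setOrbits G n, (ext x (first x) : ℝ) < 1 / 2 →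
      ∀ i, first x < i → i < n → ∃ l, ext x i = p l := by
    intro x hx h i hi
    induction i, hi using Nat.le_induction with
    | base => exact fun hin => hleft _ h _ (hsucc x hx _ hin)
    | succ i hi ih =>
      refine fun hin => hleft _ ?_ _ (hsucc x hx _ hin)
      obtain ⟨l, hl⟩ := ih (Nat.lt_of_succ_lt hin)
      rw [hl]
      exact hp l
  -- The code records when the orbit leaves `1/2`, the cell and the side it leaves to, and the word
  -- in the `N` points it follows afterwards if it leaves to the left. Only the word grows
  -- exponentially.
  refine ⟨ℕ × ℕ × Bool × (Fin n → Fin N),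
    Finset.range (n + 1) ×ˢ Finset.range (M + 1) ×ˢ Finset.univ ×ˢ Finset.univ,
    fun x => (first x, ⌊(ext x (first x) : ℝ) / ε⌋₊, decide (1 / 2 < (ext x (first x) : ℝ)),
      word x), ?_, ?_, ?_⟩
  · simp only [Finset.card_product, Finset.card_range, Finset.card_univ, Fintype.card_bool,
      Fintype.card_fun, Fintype.card_fin]
    have h1 := natCast_add_one_le_mul_exp (sub_pos.2 hB) n
    have h2 : Real.exp (B * n) = Real.exp ((B - Real.log N) * n) * (N : ℝ) ^ n := by
      rw [← Real.exp_log hN0, ← Real.exp_nat_mul, Real.log_exp, ← Real.exp_add]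
      ring_nf
    push_cast
    rw [h2]
    calc ((n : ℝ) + 1) * ((M + 1) * (2 * (N : ℝ) ^ n))
        ≤ ((1 + 1 / (B - Real.log N)) * Real.exp ((B - Real.log N) * n)) *
          ((M + 1) * (2 * (N : ℝ) ^ n)) := by gcongr
      _ = _ := by ring
  · intro x _
    simp only [Finset.mem_product, Finset.mem_range, Finset.mem_univ, and_true]
    exact ⟨Nat.lt_succ_of_le (hle x), Nat.lt_succ_of_le (floor_div_le_floor_one_div hε _)⟩
  · intro x hx y hy h i
    simp only [Prod.mk.injEq, decide_eq_decide] at h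
    obtain ⟨hk, hcell, hflag, hw⟩ := h
    rw [← hext x i, ← hext y i]
    rcases lt_trichotomy (i : ℕ) (first x) with hi | hi | hi
    · rw [Subtype.ext ((hbefore x i hi).trans (hbefore y i (hk ▸ hi)).symm), dist_self]
      exact hε.le
    · rw [hi]
      nth_rw 2 [hk]
      exact dist_le_of_floor_div_eq hε hcell
    · rcases lt_or_gt_of_ne (Nat.find_spec (hex x)) with hlt | hgt
      · have hlt' := lt_of_le_of_ne (not_lt.1 fun h => hlt.not_gt (hflag.2 h))
          (Nat.find_spec (hex y))
        have h1 := hafter_left x hx hlt i hi i.2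
        have h2 := hafter_left y hy hlt' i (hk ▸ hi) i.2
        rw [hext] at h1 h2 ⊢
        rw [hext, hword x i h1, hword y i h2, hw, dist_self]
        exact hε.le
      · rw [hafter_right x hx hgt i hi i.2, hafter_right y hy (hflag.1 hgt) i (hk ▸ hi) i.2,
          dist_self]
        exact hε.le

/-! ### The zigzag fold and the staircase -/

/-- A continuous map of the interval oscillating `N` times between `0` and `1/2` before it reaches
`1`. -/
noncomputable def zigzag (N : ℕ) : C(I, I) where
  toFun x := ⟨max (min (triWave (2 * N * x)) (1 / 2)) (2 * N * x - (2 * N - 1)),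
    le_max_of_le_left (le_min (triWave_nonneg _) (by norm_num)),
    max_le ((min_le_right _ _).trans (by norm_num)) (by
      have : (2 * N * x : ℝ) ≤ 2 * N := mul_le_of_le_one_right (by positivity) x.2.2
      linarith)⟩
  continuous_toFun := by
    have := continuous_triWave
    fun_prop

/-- A sum of `N` unit ramps, the `l`-th one from `2 l + 1/2` to `2 l + 3/2`. -/
noncomputable def rampSum (N : ℕ) (t : ℝ) : ℝ :=
  ∑ l ∈ Finset.range N, max 0 (min 1 (t - 2 * l - 1 / 2))

/-- A monotone staircase map of the interval that is constant on each set where the map `zigzag N`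
oscillates. -/
noncomputable def staircase (N : ℕ) : C(I, I) where
  toFun x := ⟨min (2 * (N : ℝ)) ((2 + 1 / (2 * N)) * rampSum N (2 * N * x)) / (2 * N),
    by
      have : 0 ≤ rampSum N (2 * N * x) := Finset.sum_nonneg fun l _ => le_max_left _ _
      positivity,
    div_le_one_of_le₀ (min_le_left _ _) (by positivity)⟩
  continuous_toFun := by
    unfold rampSum
    fun_prop

lemma coe_zigzag (N : ℕ) (x : I) : (zigzag N x : ℝ) =
    max (min (triWave (2 * N * x)) (1 / 2)) (2 * N * x - (2 * N - 1)) := rfl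

lemma coe_staircase (N : ℕ) (x : I) : (staircase N x : ℝ) =
    min (2 * (N : ℝ)) ((2 + 1 / (2 * N)) * rampSum N (2 * N * x)) / (2 * N) := rfl

lemma staircase_monotone (N : ℕ) : Monotone (staircase N) := by
  intro x y hxy
  have hxy : (x : ℝ) ≤ y := hxy
  rw [← Subtype.coe_le_coe, coe_staircase, coe_staircase, rampSum, rampSum]
  gcongr

/-- Here the ramps with index below `l` are complete and the others have not begun. -/
lemma rampSum_eq {N l : ℕ} (hl : l ≤ N) {t : ℝ} (h1 : 2 * l - 1 / 2 ≤ t)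
    (h2 : l < N → t ≤ 2 * l + 1 / 2) : rampSum N t = l := by
  have : ∀ j ∈ Finset.range N, max 0 (min 1 (t - 2 * j - 1 / 2)) = if j < l then (1 : ℝ) else 0 := by
    intro j hj
    split_ifs with h
    · have : (j : ℝ) + 1 ≤ l := by exact_mod_cast h
      rw [min_eq_left (by linarith), max_eq_right zero_le_one]
    · have hlj : (l : ℝ) ≤ j := by exact_mod_cast not_lt.1 h
      have := h2 (lt_of_le_of_lt (not_lt.1 h) (Finset.mem_range.1 hj))
      exact max_eq_left ((min_le_right _ _).trans (by linarith))
  rw [rampSum, Finset.sum_congr rfl this, Finset.sum_boole]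
  have : {j ∈ Finset.range N | j < l} = Finset.range l := by
    ext j
    simp only [Finset.mem_filter, Finset.mem_range]
    omega
  rw [this, Finset.card_range]

section Zigzag

variable {N : ℕ}

lemma zigzag_eq_one_iff (hN : 1 ≤ N) (x : I) : zigzag N x = 1 ↔ x = 1 := by
  have hN0 : (0 : ℝ) < N := by exact_mod_cast hN
  rw [Subtype.ext_iff, Subtype.ext_iff, coe_zigzag, Icc.coe_one]
  constructor
  · intro h
    rcases max_choice (min (triWave (2 * N * x)) (1 / 2)) (2 * N * (x : ℝ) - (2 * N - 1))
      with h' | h'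
    · have := min_le_right (triWave (2 * N * x)) (1 / 2)
      linarith
    · have : 2 * N * ((x : ℝ) - 1) = 0 := by linarith
      rcases mul_eq_zero.1 this with h | h
      · linarith
      · linarith
  · intro h
    rw [h, max_eq_right]
    · ring
    · have := min_le_right (triWave (2 * N * 1)) (1 / 2)
      linarith

lemma zigzag_zero (hN : 1 ≤ N) : zigzag N 0 = 0 := by
  have hN1 : (1 : ℝ) ≤ N := by exact_mod_cast hN
  refine Subtype.ext ?_
  rw [coe_zigzag, Icc.coe_zero, mul_zero, triWave_eq (z := 0) (by simp)]
  simp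
  linarith

lemma zigzag_surjective (hN : 1 ≤ N) : Function.Surjective (zigzag N) := by
  intro y
  obtain ⟨x, -, hx⟩ := intermediate_value_Icc (zero_le_one (α := I)) (zigzag N).continuous.continuousOn
    (show y ∈ Icc (zigzag N 0) (zigzag N 1) by
      rw [zigzag_zero hN, (zigzag_eq_one_iff hN 1).2 rfl]
      exact ⟨y.2.1, y.2.2⟩)
  exact ⟨x, hx⟩

lemma staircase_zero (N : ℕ) : staircase N 0 = 0 := by
  refine Subtype.ext ?_
  rw [coe_staircase, rampSum_eq (l := 0) (Nat.zero_le _)] <;> simp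

lemma staircase_eq_one (hN : 1 ≤ N) {x : I} (hx : 2 * N - 1 / 2 ≤ 2 * N * (x : ℝ)) :
    staircase N x = 1 := by
  have hN0 : (0 : ℝ) < N := by exact_mod_cast hN
  refine Subtype.ext ?_
  rw [coe_staircase, rampSum_eq le_rfl hx fun h => absurd h (lt_irrefl _), min_eq_left,
    div_self (by positivity), Icc.coe_one]
  have : (0 : ℝ) ≤ 1 / (2 * N) * N := by positivity
  linarith

/-- The ramp factor `2 + 1 / (2 * N)` is chosen so that the `l`-th plateau has its height inside the
`l`-th oscillation, at the point where `zigzag N` equals `l / (2 * N)`. The cap takes effect only on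
the last plateau. -/
lemma staircase_eq {l : ℕ} (hl : l < N) {x : I} (h1 : 2 * l - 1 / 2 ≤ 2 * N * (x : ℝ))
    (h2 : 2 * N * (x : ℝ) ≤ 2 * l + 1 / 2) :
    2 * N * (staircase N x : ℝ) = 2 * l + l / (2 * N) := by
  have hN0 : (0 : ℝ) < N := by exact_mod_cast (Nat.zero_le l).trans_lt hl
  have hl' : (l : ℝ) + 1 ≤ N := by exact_mod_cast hl
  have h3 : (l : ℝ) / (2 * N) ≤ 1 := by
    rw [div_le_one (by positivity)]
    linarith
  have h4 : (2 + 1 / (2 * N)) * (l : ℝ) = 2 * l + l / (2 * N) := by ring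
  rw [coe_staircase, rampSum_eq hl.le h1 fun _ => h2, mul_div_cancel₀ _ (by positivity), h4,
    min_eq_right (by linarith)]

/-- On the `l`-th oscillation the map `zigzag N` is the distance to its minimum. -/
lemma zigzag_eq {l j : ℕ} (hl : l < N) (hj : j < N) {x : I}
    (h : 2 * N * (x : ℝ) = 2 * l + j / (2 * N)) : (zigzag N x : ℝ) = j / (2 * N) := by
  have hN0 : (0 : ℝ) < N := by exact_mod_cast (Nat.zero_le l).trans_lt hl
  have hl' : (l : ℝ) + 1 ≤ N := by exact_mod_cast hl
  have hj' : (j : ℝ) < N := by exact_mod_cast hj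
  have h0 : (0 : ℝ) ≤ j / (2 * N) := by positivity
  have h1 : (j : ℝ) / (2 * N) ≤ 1 / 2 := by
    rw [div_le_iff₀ (by positivity)]
    linarith
  have h2 : |2 * (l : ℝ) + j / (2 * N) - 2 * (l : ℤ)| = j / (2 * N) := by
    rw [Int.cast_natCast, add_sub_cancel_left, abs_of_nonneg h0]
  rw [coe_zigzag, h, triWave_eq (z := (l : ℤ)) (by rw [h2]; linarith), h2, min_eq_left h1,
    max_eq_left (by linarith)]

lemma exists_of_zigzag_lt {x : I} (hx : (zigzag N x : ℝ) < 1 / 2) : ∃ l < N,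
    2 * l - 1 / 2 ≤ 2 * N * (x : ℝ) ∧ 2 * N * (x : ℝ) ≤ 2 * l + 1 / 2 := by
  rw [coe_zigzag, max_lt_iff, min_lt_iff] at hx
  have h1 : triWave (2 * N * x) < 1 / 2 := hx.1.resolve_right (lt_irrefl _)
  have h0 : (0 : ℝ) ≤ 2 * N * x := mul_nonneg (by positivity) x.2.1
  rw [triWave, abs_lt] at h1
  set z := round (2 * N * (x : ℝ) / 2)
  have hz0 : (-1 : ℝ) < z := by linarith
  have hz0' : 0 ≤ z := by
    have : (-1 : ℤ) < z := by exact_mod_cast hz0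
    omega
  have hzN : (z : ℝ) < N := by linarith
  obtain ⟨l, hl⟩ := Int.eq_ofNat_of_zero_le hz0'
  rw [hl] at hzN h1
  simp only [Int.cast_natCast] at hzN h1
  exact ⟨l, by exact_mod_cast hzN, by linarith, by linarith⟩

/-- The points among which the folded staircase map moves freely. -/
noncomputable def foldPoint (N : ℕ) (l : Fin N) : I :=
  ⟨l / (2 * N), by positivity, div_le_one_of_le₀ (by
    have : ((l : ℕ) : ℝ) < N := by exact_mod_cast l.2
    linarith [Nat.cast_nonneg (α := ℝ) N]) (by positivity)⟩

lemma foldPoint_injective : Function.Injective (foldPoint N) := by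
  intro j l h
  have hN0 : (0 : ℝ) < N := by exact_mod_cast j.pos
  have h : ((j : ℕ) : ℝ) / (2 * N) = (l : ℕ) / (2 * N) := congrArg Subtype.val h
  rw [div_left_inj' (by positivity)] at h
  exact Fin.ext (by exact_mod_cast h)

/-- The `j`-th point has a zigzag preimage in every oscillation; taking the one in the `l`-th, the
staircase and the zigzag lead to the `l`-th point whatever `j` is. -/
lemma foldPoint_mem_foldRel (j l : Fin N) :
    foldPoint N l ∈ foldRel (zigzag N) (staircase N) (foldPoint N j) := by
  have hN0 : (0 : ℝ) < N := by exact_mod_cast j.pos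
  have hl : ((l : ℕ) : ℝ) + 1 ≤ N := by exact_mod_cast l.2
  have hj : ((j : ℕ) : ℝ) < N := by exact_mod_cast j.2
  have hj0 : (0 : ℝ) ≤ (j : ℕ) / (2 * N) := by positivity
  have hj1 : ((j : ℕ) : ℝ) / (2 * N) ≤ 1 / 2 := by
    rw [div_le_iff₀ (by positivity)]
    linarith
  obtain ⟨x, hx⟩ : ∃ x : I, 2 * N * (x : ℝ) = 2 * (l : ℕ) + (j : ℕ) / (2 * N) :=
    ⟨⟨(2 * (l : ℕ) + (j : ℕ) / (2 * N)) / (2 * N), by positivity,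
      div_le_one_of_le₀ (by linarith) (by positivity)⟩, mul_div_cancel₀ _ (by positivity)⟩
  exact ⟨x, Subtype.ext (zigzag_eq l.2 j.2 hx),
    Subtype.ext (zigzag_eq l.2 l.2 (staircase_eq l.2 (by linarith) (by linarith)))⟩

/-- A zigzag value below `1/2` comes from an oscillation, where the staircase is constant; a value
above `1/2` comes from the final ramp, where it is 1. Only `1/2` has preimages on the rising parts
of the staircase. -/
lemma entropyBound_foldRel_zigzag (hN : 1 ≤ N) :
    EntropyBound (foldRel (zigzag N) (staircase N)) (Real.log N) := by
  have hN0 : (0 : ℝ) < N := by exact_mod_cast hN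
  refine entropyBound_of_half hN (p := foldPoint N) (fun l => ?_) ?_ ?_
  · have : ((l : ℕ) : ℝ) < N := by exact_mod_cast l.2
    change ((l : ℕ) : ℝ) / (2 * N) < 1 / 2
    rw [div_lt_iff₀ (by positivity)]
    linarith
  · rintro _ hx _ ⟨s, rfl, rfl⟩
    obtain ⟨l, hl, h1, h2⟩ := exists_of_zigzag_lt hx
    exact ⟨⟨l, hl⟩, Subtype.ext (zigzag_eq hl hl (staircase_eq hl h1 h2))⟩
  · rintro _ hx _ ⟨s, rfl, rfl⟩
    rw [coe_zigzag, lt_max_iff, lt_min_iff] at hx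
    have h := hx.resolve_left fun h => lt_irrefl _ h.2
    rw [staircase_eq_one hN (by linarith)]
    exact (zigzag_eq_one_iff hN 1).2 rfl

end Zigzag

/-! ### The diagonal systems -/

/-- Every finite entropy of the diagonal map is compatible with any sequence of larger entropies
`log (N i)` of the set-valued maps. -/
lemma exists_diagonal_system_of_real {a : ℝ} (ha : 0 ≤ a) (N : ℕ → ℕ) (hN : ∀ i, 1 ≤ N i)
    (haN : ∀ i, a ≤ Real.log (N i)) :
    ∃ (f g : ℕ → C(I, I)) (h : ∀ i, (f i).comp (g (i + 1)) = (g i).comp (f (i + 1))),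
      (∀ i, Function.Surjective (f i)) ∧ mapEntropy (diagonalMap f g h) = a ∧
      ∀ i, setEntropy (compInv (g (i + 1)) (f (i + 1))) = ((Real.log (N i) : ℝ) : EReal) := by
  set D := waveMap (Real.exp a)
  set E : ℕ → C(I, I) := fun i => staircase (N i)
  set α : ℕ → C(I, I) := fun i => zigzag (N i)
  have hl : 1 ≤ Real.exp a := Real.one_le_exp ha
  have hD : D 0 = 0 := waveMap_zero _
  have hE : ∀ i, E i 0 = 0 := fun i => staircase_zero (N i)
  have hE1 : ∀ i, E i 1 = 1 := fun i => staircase_eq_one (hN i) (by simp)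
  have hα : ∀ i s, α i s = 1 ↔ s = 1 := fun i s => zigzag_eq_one_iff (hN i) s
  have hα1 : ∀ i, α i 1 = 1 := fun i => (hα i 1).2 rfl
  have hs : ∀ i, Function.Surjective (α i) := fun i => zigzag_surjective (hN i)
  have hbound : ∀ i, EntropyBound (fun x => {towerMap D E i x}) a := by
    intro i
    induction i with
    | zero =>
      have := entropyBound_of_lipschitz hl (dist_waveMap_le (Real.exp_pos a).le)
      rwa [Real.log_exp] at this
    | succ i ih =>
      exact entropyBound_joinMap (hE1 i) (towerMap_zero hD hE i)
        ((staircase_monotone (N i)).entropyBound.mono ha) ih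
  refine ⟨towerBonding α, towerDiagonal D E α, tower_comm hD hE hE1 hα1,
    towerBonding_surjective hα1 hs, le_antisymm ?_ ?_, fun i => ?_⟩
  · exact (entropyBound_diagonalMap_tower hD hE hE1 hα1 _ hbound).setEntropy_le
  -- Level 0 of the tower is the wave of slope `exp a` itself.
  · refine le_trans ?_ (mapEntropy_towerMap_le_diagonalMap hD hE hE1 hα1 hs _ 0)
    have := log_le_mapEntropy_waveMap hl
    rwa [Real.log_exp] at this
  · rw [compInv_tower]
    refine le_antisymm ?_ ?_
    · exact (entropyBound_foldRel_tower hD hE hE1 hα i ((hbound i).mono (haN i))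
        (entropyBound_foldRel_zigzag (hN i))).setEntropy_le
    · exact log_le_setEntropy_foldRel_tower (hN i) hD hE hE1 hα1 i foldPoint_injective
        fun j l => foldPoint_mem_foldRel j l

lemma tendsto_log_natCast_top {N : ℕ → ℕ} (hN : ∀ i, i ≤ N i) :
    Tendsto (fun i => ((Real.log (N i) : ℝ) : EReal)) atTop (𝓝 ⊤) :=
  EReal.tendsto_coe_nhds_top_iff.2 (Real.tendsto_log_atTop.comp
    (tendsto_natCast_atTop_atTop.comp (tendsto_atTop_mono hN tendsto_id)))

/-- There is a diagonal system all of whose entropies are infinite in the limit. -/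
lemma exists_diagonal_system_top :
    ∃ (f g : ℕ → C(I, I)) (h : ∀ i, (f i).comp (g (i + 1)) = (g i).comp (f (i + 1))),
      (∀ i, Function.Surjective (f i)) ∧ mapEntropy (diagonalMap f g h) = ⊤ ∧
      Tendsto (fun i => setEntropy (compInv (g i) (f i))) atTop (𝓝 ⊤) := by
  set D := ContinuousMap.id I
  set E : ℕ → C(I, I) := fun i => waveMap (2 * i + 1)
  set α : ℕ → C(I, I) := fun _ => ContinuousMap.id I
  have hD : D 0 = 0 := rfl
  have hE : ∀ i, E i 0 = 0 := fun i => waveMap_zero _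
  have hE1 : ∀ i, E i 1 = 1 := fun i => waveMap_odd_one i
  have hα1 : ∀ i, α i 1 = 1 := fun i => rfl
  have hs : ∀ i, Function.Surjective (α i) := fun i => Function.surjective_id
  have hlow : ∀ i : ℕ, ((Real.log (2 * i + 1 : ℕ) : ℝ) : EReal) ≤
      mapEntropy (towerMap D E (i + 1)) := by
    intro i
    refine le_trans ?_ (mapEntropy_left_le_joinMap (hE1 i) (towerMap_zero hD hE i))
    have := log_le_mapEntropy_waveMap (l := 2 * i + 1)
      (by linarith [Nat.cast_nonneg (α := ℝ) i])
    exact (by exact_mod_cast this : _ ≤ mapEntropy (waveMap (2 * i + 1)))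
  have htop := tendsto_log_natCast_top (N := fun i => 2 * i + 1) fun i => by omega
  have hfold : ∀ i, towerFold α i = ContinuousMap.id I := by
    intro i
    cases i with
    | zero => rfl
    | succ i => exact ContinuousMap.ext fun x => Subtype.ext (coe_eq_collapse x).symm
  refine ⟨towerBonding α, towerDiagonal D E α, tower_comm hD hE hE1 hα1,
    towerBonding_surjective hα1 hs, ?_, ?_⟩
  · exact top_le_iff.1 (le_of_tendsto' htop fun i => (hlow i).trans
      (mapEntropy_towerMap_le_diagonalMap hD hE hE1 hα1 hs _ (i + 1)))
  · refine (tendsto_add_atTop_iff_nat 1).1 (tendsto_of_tendsto_of_tendsto_of_le_of_le htop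
      tendsto_const_nhds (fun i => ?_) fun i => le_top)
    rw [compInv_tower, hfold, foldRel_id]
    exact hlow i

lemma liminf_limsup_alternating {N M : ℕ → ℕ} {b c : EReal} (hbc : b ≤ c)
    (hN : Tendsto (fun i => ((Real.log (N i) : ℝ) : EReal)) atTop (𝓝 b))
    (hM : Tendsto (fun i => ((Real.log (M i) : ℝ) : EReal)) atTop (𝓝 c)) :
    liminf (fun i => ((Real.log ((if Even i then N i else M i : ℕ)) : ℝ) : EReal)) atTop = b ∧
      limsup (fun i => ((Real.log ((if Even i then N i else M i : ℕ)) : ℝ) : EReal)) atTop = c := by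
  refine ⟨le_antisymm ?_ ?_, le_antisymm ?_ ?_⟩
  · refine le_of_forall_gt_imp_ge_of_dense fun x hx => liminf_le_of_frequently_le
      ((Nat.frequently_even.and_eventually (hN.eventually_lt_const hx)).mono ?_)
    rintro i ⟨hi, h⟩
    rw [if_pos hi]
    exact h.le
  · refine le_of_forall_lt_imp_le_of_dense fun x hx => le_liminf_of_le (by isBoundedDefault) ?_
    filter_upwards [hN.eventually_const_lt hx, hM.eventually_const_lt (hx.trans_le hbc)]
      with i h1 h2
    split_ifs
    exacts [h1.le, h2.le]
  · refine le_of_forall_gt_imp_ge_of_dense fun x hx => limsup_le_of_le (by isBoundedDefault) ?_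
    filter_upwards [hN.eventually_lt_const (hbc.trans_lt hx), hM.eventually_lt_const hx]
      with i h1 h2
    split_ifs
    exacts [h1.le, h2.le]
  · refine le_of_forall_lt_imp_le_of_dense fun x hx => le_limsup_of_frequently_le
      ((Nat.frequently_odd.and_eventually (hM.eventually_const_lt hx)).mono ?_)
    rintro i ⟨hi, h⟩
    rw [if_neg (Nat.not_even_iff_odd.2 hi)]
    exact h.le

lemma exists_diagonal_system (a b c : EReal) (ha : 0 ≤ a) (hab : a ≤ b) (hbc : b ≤ c)
    (hb : (∃ n : ℕ, 1 ≤ n ∧ b = ((Real.log n : ℝ) : EReal)) ∨ b = ⊤)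
    (hc : (∃ m : ℕ, 1 ≤ m ∧ c = ((Real.log m : ℝ) : EReal)) ∨ c = ⊤) :
    ∃ (f g : ℕ → C(I, I)) (h : ∀ i, (f i).comp (g (i + 1)) = (g i).comp (f (i + 1))),
      (∀ i, Function.Surjective (f i)) ∧
      mapEntropy (diagonalMap f g h) = a ∧
      liminf (fun i => setEntropy (compInv (g i) (f i))) atTop = b ∧
      limsup (fun i => setEntropy (compInv (g i) (f i))) atTop = c := by
  -- Infinite `a` forces `b` and `c` to be infinite too.
  rcases eq_or_ne a ⊤ with rfl | ha'
  · obtain ⟨f, g, h, hf, hΨ, ht⟩ := exists_diagonal_system_top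
    refine ⟨f, g, h, hf, hΨ, ?_, ?_⟩
    · rw [ht.liminf_eq, top_le_iff.1 hab]
    · rw [ht.limsup_eq, top_le_iff.1 (hab.trans hbc)]
  lift a to ℝ using ⟨ha', ne_bot_of_le_ne_bot (by simp) ha⟩
  have ha0 : 0 ≤ a := by exact_mod_cast ha
  -- sequences of integers with prescribed limit of logarithms, bounded below by `a`
  have hseq : ∀ e : EReal, (a : EReal) ≤ e →
      ((∃ n : ℕ, 1 ≤ n ∧ e = ((Real.log n : ℝ) : EReal)) ∨ e = ⊤) →
      ∃ N : ℕ → ℕ, (∀ i, 1 ≤ N i) ∧ (∀ i, a ≤ Real.log (N i)) ∧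
        Tendsto (fun i => ((Real.log (N i) : ℝ) : EReal)) atTop (𝓝 e) := by
    rintro e hae (⟨n, hn, rfl⟩ | rfl)
    · exact ⟨fun _ => n, fun _ => hn, fun _ => by exact_mod_cast hae, tendsto_const_nhds⟩
    · have hpos : 0 < ⌈Real.exp a⌉₊ := Nat.ceil_pos.2 (Real.exp_pos a)
      -- Starting at `⌈exp a⌉` keeps every logarithm at least `a`.
      refine ⟨fun i => ⌈Real.exp a⌉₊ + i, fun i => le_add_right hpos, fun i => ?_,
        tendsto_log_natCast_top fun i => by omega⟩
      rw [Real.le_log_iff_exp_le (by positivity)]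
      push_cast
      linarith [Nat.le_ceil (Real.exp a), Nat.cast_nonneg (α := ℝ) i]
  obtain ⟨N, hN1, haN, hN⟩ := hseq b hab hb
  obtain ⟨M, hM1, haM, hM⟩ := hseq c (hab.trans hbc) hc
  obtain ⟨f, g, h, hf, hΨ, hG⟩ := exists_diagonal_system_of_real ha0
    (fun i => if Even i then N i else M i)
    (fun i => by split_ifs; exacts [hN1 i, hM1 i])
    (fun i => by split_ifs; exacts [haN i, haM i])
  refine ⟨f, g, h, hf, hΨ, ?_, ?_⟩
  -- Level 0 carries no fold, so the prescribed entropies start at level 1.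
  · rw [← liminf_nat_add _ 1]
    simp only [hG]
    exact (liminf_limsup_alternating hbc hN hM).1
  · rw [← limsup_nat_add _ 1]
    simp only [hG]
    exact (liminf_limsup_alternating hbc hN hM).2

theorem mainTheorem7 :
    (∀ a b c : EReal, 0 ≤ a → a ≤ b → b ≤ c →
      ((∃ n : ℕ, 1 ≤ n ∧ b = ((Real.log n : ℝ) : EReal)) ∨ b = ⊤) →
      ((∃ m : ℕ, 1 ≤ m ∧ c = ((Real.log m : ℝ) : EReal)) ∨ c = ⊤) →
      ∃ (f g : ℕ → C(I, I)) (h : ∀ i, (f i).comp (g (i + 1)) = (g i).comp (f (i + 1))),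
        (∀ i, Function.Surjective (f i)) ∧
        mapEntropy (diagonalMap f g h) = a ∧
        liminf (fun i => setEntropy (compInv (g i) (f i))) atTop = b ∧
        limsup (fun i => setEntropy (compInv (g i) (f i))) atTop = c) ∧
    (∃ (f g : ℕ → C(I, I)) (_ : ∀ i, (f i).comp (g (i + 1)) = (g i).comp (f (i + 1))),
        (∀ i, Function.Surjective (f i)) ∧
        ¬ ∃ L : EReal, Tendsto (fun i => setEntropy (compInv (g i) (f i))) atTop (𝓝 L)) ∧
    (∃ (f g : ℕ → C(I, I)) (h : ∀ i, (f i).comp (g (i + 1)) = (g i).comp (f (i + 1))),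
        (∀ i, Function.Surjective (f i)) ∧
        mapEntropy (diagonalMap f g h) <
          liminf (fun i => setEntropy (compInv (g i) (f i))) atTop) := by
  have h1 : (0 : EReal) = ((Real.log (1 : ℕ) : ℝ) : EReal) := by simp
  have h2 : (0 : EReal) < ((Real.log (2 : ℕ) : ℝ) : EReal) := by
    exact_mod_cast Real.log_pos (by norm_num)
  refine ⟨exists_diagonal_system, ?_, ?_⟩
  -- With `b = 0` and `c = log 2` the lower and upper limits differ.
  · obtain ⟨f, g, h, hf, -, hinf, hsup⟩ := exists_diagonal_system 0 0 _ le_rfl le_rfl h2.le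
      (Or.inl ⟨1, le_rfl, h1⟩) (Or.inl ⟨2, one_le_two, rfl⟩)
    refine ⟨f, g, h, hf, ?_⟩
    rintro ⟨L, hL⟩
    rw [hL.liminf_eq] at hinf
    rw [hL.limsup_eq, hinf] at hsup
    exact h2.ne hsup
  -- With `a = 0` and `b = c = log 2` the inequality is strict.
  · obtain ⟨f, g, h, hf, hΨ, hinf, -⟩ := exists_diagonal_system 0 _ _ le_rfl h2.le le_rfl
      (Or.inl ⟨2, one_le_two, rfl⟩) (Or.inl ⟨2, one_le_two, rfl⟩)
    refine ⟨f, g, h, hf, ?_⟩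
    rw [hΨ, hinf]
    exact h2
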